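/- All graphs are finite and simple. For an integer $k\ge 0$, a $k$-queue layout of a graph $G$ consists of a linear ordering $\preceq$ of $V(G)$ and a partition $E_1,\dots,E_k$ of $E(G)$ (classes may be empty) such that no class contains two edges $vw$ and $xy$ that are nested, that is, with $v\prec x\prec y\prec w$. The queue-number of $G$ is the minimum $k$ such that $G$ has a $k$-queue layout. The Euler genus of $G$ is the minimum integer $g\ge 0$ such that $G$ embeds in the sphere with $g/2$ handles ($g$ even) or the sphere with $g$ cross-caps; $G$ is planar if and only if it has Euler genus $0$. Embeddings are described combinatorially, as usual, by embedding schemes (a cyclic ordering of the edges at each vertex and a signature $\pm 1$ on each edge): if such a scheme on a graph with $n$ vertices, $m$ edges and $c$ components has $f$ faces in total, the components being embedded separately (so that an isolated vertex has one face), then its Euler genus is $2c-(n-m+f)$, and the Euler genus of $G$ is the minimum of this number over all schemes of $G$. Theorem. Let $k$ and $g$ be non-negative integers. If every planar graph has queue-number at most $k$, then every graph with Euler genus $g$ has queue-number at most $3k+4g$. -/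

import Mathlib

universe u

namespace SimpleGraph

variable {V : Type u}

/-! ### Queue layouts -/

/-- A `k`-queue layout of `G`: a linear ordering of the vertices, together with a partition of the
edges into `k` (possibly empty) classes, no class of which contains two nested edges. The edges
`vw` and `xy` are nested if `v < x < y < w`. -/
structure QueueLayout (G : SimpleGraph V) (k : ℕ) where
  /-- the ordering of the vertices -/
  order : LinearOrder V
  /-- the class to which an edge belongs -/
  queue : G.edgeSet → Fin k
  not_nested : ∀ (v w x y : V) (hvw : G.Adj v w) (hxy : G.Adj x y),
    order.lt v x → order.lt x y → order.lt y w →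
      queue ⟨s(v, w), hvw⟩ ≠ queue ⟨s(x, y), hxy⟩

/-- The queue-number: the least `k` such that `G` has a `k`-queue layout. -/
noncomputable def queueNumber (G : SimpleGraph V) : ℕ :=
  sInf {k : ℕ | Nonempty (G.QueueLayout k)}

/-- A finite graph has a queue layout (one queue for each edge), so that the infimum in the
definition of the queue-number is a minimum. -/
theorem nonempty_queueLayout_queueNumber [Finite V] (G : SimpleGraph V) :
    Nonempty (G.QueueLayout G.queueNumber) := by
  have h : {k : ℕ | Nonempty (G.QueueLayout k)}.Nonempty := by
    obtain ⟨n, ⟨e⟩⟩ := Finite.exists_equiv_fin V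
    obtain ⟨m, ⟨q⟩⟩ := Finite.exists_equiv_fin G.edgeSet
    let o : LinearOrder V := LinearOrder.lift' e e.injective
    refine ⟨m, ⟨⟨o, q, ?_⟩⟩⟩
    intro v w x y hvw hxy h1 h2 h3 heq
    have h4 : s(v, w) = s(x, y) := congrArg Subtype.val (q.injective heq)
    have h1' : v < x := h1
    have h2' : x < y := h2
    rcases Sym2.eq_iff.1 h4 with ⟨h, -⟩ | ⟨h, -⟩
    · exact absurd h h1'.ne
    · exact absurd h (h1'.trans h2').ne
  exact Nat.sInf_mem h

/-! ### Embeddings in surfaces -/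

/-- A (general) embedding scheme of `G`: at every vertex a cyclic ordering of the edges at that
vertex, and for every edge a signature which says whether the two local orientations at its ends
disagree along the edge. Here a dart is an edge with a direction, and stands for the end of the
edge at the tail `d.fst`. Embedding schemes describe the cellular embeddings of a connected
graph in closed surfaces, orientable or not; for a disconnected graph each component is embedded
in a surface of its own. -/
structure EmbeddingScheme (G : SimpleGraph V) where
  /-- the dart that follows a given dart in the cyclic (say anticlockwise) order at its tail -/
  rot : Equiv.Perm G.Dart
  rot_isCycleOn : ∀ v : V, rot.IsCycleOn {d | d.fst = v}
  /-- the signature: `true` for a twisted (orientation-reversing) edge -/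
  twisted : G.edgeSet → Bool

namespace EmbeddingScheme

variable {G : SimpleGraph V}

/-- Tracing the boundaries of faces. The pair `(d, b)` stands for that side of the edge of `d`,
near the tail of `d`, which comes directly after `d` (`b = true`) or directly before `d`
(`b = false`) in the cyclic order at the tail. Such a side is followed around the corner of
the face at the tail, or along the edge to its other end. -/
inductive FaceStep (R : G.EmbeddingScheme) : G.Dart × Bool → G.Dart × Bool → Prop
  | corner (d : G.Dart) : FaceStep R (d, true) (R.rot d, false)
  | along (d : G.Dart) (b : Bool) :
      FaceStep R (d, b) (d.symm, if R.twisted ⟨d.edge, d.edge_mem⟩ then b else !b)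

/-- The facial walks of positive length: the classes of edge sides under the equivalence relation
generated by the steps. -/
def FacialWalk (R : G.EmbeddingScheme) : Type u :=
  Quot R.FaceStep

/-- The number of faces. A component that is a single vertex, embedded in a sphere, has one face,
which has no edges on its boundary. -/
noncomputable def numFaces (R : G.EmbeddingScheme) : ℕ :=
  Nat.card R.FacialWalk + Nat.card {v : V // G.IsIsolated v}

/-- The Euler genus of the surface of an embedding scheme, by Euler's formula: `2 - (n - m + f)` for
a connected graph, and the sum of these numbers over the components in general (the Euler
genus of the connected sum of the surfaces of the components). -/
noncomputable def eulerGenus (R : G.EmbeddingScheme) : ℤ :=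
  2 * (Nat.card G.ConnectedComponent : ℤ)
    - ((Nat.card V : ℤ) - (Nat.card G.edgeSet : ℤ) + (R.numFaces : ℤ))

end EmbeddingScheme

/-- `G` embeds, cellularly or not, in some closed connected surface of Euler genus `g` (a sphere with
`g / 2` handles, or with `g` cross-caps): it has an embedding scheme of Euler genus at most `g`. -/
def EmbedsInEulerGenus (G : SimpleGraph V) (g : ℕ) : Prop :=
  ∃ R : G.EmbeddingScheme, R.eulerGenus ≤ (g : ℤ)

/-- The Euler genus of a graph: the least `g` such that `G` embeds in a surface of Euler genus `g`. -/
noncomputable def eulerGenus (G : SimpleGraph V) : ℕ :=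
  sInf {g : ℕ | G.EmbedsInEulerGenus g}

/-- A graph is planar if it embeds in the sphere, the surface of Euler genus `0`. -/
def IsPlanar (G : SimpleGraph V) : Prop :=
  G.EmbedsInEulerGenus 0

/-- A finite graph has an embedding scheme. -/
theorem nonempty_embeddingScheme [Finite V] (G : SimpleGraph V) :
    Nonempty G.EmbeddingScheme := by
  have key : ∀ v : V, ∃ f : Equiv.Perm G.Dart, f.IsCycleOn {d | d.fst = v} := by
    intro v
    have : Finite G.Dart :=
      Finite.of_injective (fun d : G.Dart => d.toProd) SimpleGraph.Dart.toProd_injective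
    obtain ⟨f, hf, -⟩ := (Set.toFinite {d : G.Dart | d.fst = v}).countable.exists_cycleOn
    exact ⟨f, hf⟩
  choose f hf using key
  have hfst : ∀ (v : V) (d : G.Dart), d.fst = v → (f v d).fst = v :=
    fun v d hd => (hf v).1.mapsTo hd
  have hfst' : ∀ (v : V) (d : G.Dart), d.fst = v → ((f v)⁻¹ d).fst = v :=
    fun v d hd => ((Equiv.Perm.isCycleOn_inv).2 (hf v)).1.mapsTo hd
  let σ : Equiv.Perm G.Dart :=
    { toFun := fun d => f d.fst d
      invFun := fun d => (f d.fst)⁻¹ d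
      left_inv := fun d => by
        change (f (f d.fst d).fst)⁻¹ (f d.fst d) = d
        rw [hfst d.fst d rfl]; simp
      right_inv := fun d => by
        change f ((f d.fst)⁻¹ d).fst ((f d.fst)⁻¹ d) = d
        rw [hfst' d.fst d rfl]; simp }
  have hσ : ∀ (v : V) (d : G.Dart), d.fst = v → σ d = f v d := by
    rintro v d rfl; rfl
  have hbij : ∀ v : V, Set.BijOn σ {d | d.fst = v} {d | d.fst = v} :=
    fun v => (hf v).1.congr (fun d hd => (hσ v d hd).symm)
  have hpow : ∀ (v : V) (n : ℕ) (d : G.Dart), d.fst = v →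
      ((f v ^ n) d).fst = v ∧ (σ ^ n) d = (f v ^ n) d := by
    intro v n d hd
    induction n with
    | zero => exact ⟨hd, rfl⟩
    | succ n ih =>
      rw [pow_succ', pow_succ', Equiv.Perm.mul_apply, Equiv.Perm.mul_apply, ih.2]
      exact ⟨hfst v _ ih.1, hσ v _ ih.1⟩
  refine ⟨⟨σ, fun v => ⟨hbij v, fun x hx y hy => ?_⟩, fun _ => false⟩⟩
  have hfin : {d : G.Dart | d.fst = v}.Finite := by
    have : Finite G.Dart :=
      Finite.of_injective (fun d : G.Dart => d.toProd) SimpleGraph.Dart.toProd_injective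
    exact Set.toFinite _
  obtain ⟨n, hn⟩ := (hf v).exists_pow_eq' hfin hx hy
  exact ⟨n, by rw [zpow_natCast, (hpow v n x hx).2, hn]⟩

/-- A finite graph embeds in a surface of Euler genus `G.eulerGenus`, so that the infimum in the
definition of the Euler genus is a minimum. -/
theorem embedsInEulerGenus_eulerGenus [Finite V] (G : SimpleGraph V) :
    G.EmbedsInEulerGenus G.eulerGenus := by
  obtain ⟨R⟩ := G.nonempty_embeddingScheme
  have h : {g : ℕ | G.EmbedsInEulerGenus g}.Nonempty :=
    ⟨R.eulerGenus.toNat, R, Int.self_le_toNat _⟩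
  exact Nat.sInf_mem h

/-- A finite graph is planar if and only if it has Euler genus `0`. -/
theorem isPlanar_iff_eulerGenus_eq_zero [Finite V] (G : SimpleGraph V) :
    G.IsPlanar ↔ G.eulerGenus = 0 := by
  constructor
  · intro h
    exact Nat.eq_zero_of_le_zero (Nat.sInf_le (s := {g : ℕ | G.EmbedsInEulerGenus g}) h)
  · intro h
    have := G.embedsInEulerGenus_eulerGenus
    rwa [h] at this

end SimpleGraph

/-!
A graph `G` of Euler genus `g` has a layering and a set `Z` with at most `2g` vertices in each
layer such that `G - Z` is planar (`exists_layering_isPlanar`). A `k`-queue layout of `G - Z` is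
rearranged layer by layer, with the vertices of `Z` first in each layer; the edges of `G - Z` then
need `3k` queues, and the edges at `Z` need two more for each of the `2g` positions in a layer
(`exists_queueLayout_of_layering`).

The set `Z` comes from cutting the surface open along a graph. Fix a scheme of `G` of Euler genus
at most `g` and a breadth-first spanning forest. As long as some edge outside the forest has
different faces on its two sides, delete it; this merges the two faces and keeps the Euler genus.
In the end there is a subgraph `A` with a single face in each component
(`exists_one_face_subgraph`), and by Euler's formula it has as many edges outside the forest as
the Euler genus of the scheme. Let `Z` consist of all ancestors of the at most `2g` ends of these
edges. The subgraph `Y` of `A` on `Z` still has the full Euler genus. The graph `G - Z` is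
disjoint from `Y`, and the Euler genus is additive for disjoint graphs and monotone for subgraphs,
so nothing is left for `G - Z` (`isPlanar_of_closed`).

All subgraphs `H` of `G` are studied on the edge sides of `G` itself: the face relation of `H`
runs along the edges of `H` and skips the others near their ends (`FaceRel`). Thus the vertex set
and the set of edge sides never change, and deleting an edge changes only the links between four
edge sides. A parity argument (`mk_eq_of_open`) says how the remaining links connect these four,
which determines how the number of faces changes. Only at the end is the relation for `G - Z`
compared with an actual embedding scheme (`exists_scheme_eulerGenus_le_subgenus`). -/

/-! ### Counting the classes of a relation -/

/-- The number of classes of the equivalence relation generated by `r`. -/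
noncomputable def numClasses {α : Type*} (r : α → α → Prop) : ℕ :=
  Nat.card (Quot r)

section Classes

variable {α : Type*}

/-- The relation `r` together with the one pair `(a, b)`. -/
def addPair (r : α → α → Prop) (a b : α) : α → α → Prop :=
  fun x y => r x y ∨ (x = a ∧ y = b)

theorem numClasses_le_of_forall_mk_eq [Finite α] {r s : α → α → Prop}
    (h : ∀ a b, r a b → Quot.mk s a = Quot.mk s b) : numClasses s ≤ numClasses r := by
  refine Nat.card_le_card_of_surjective (Quot.lift (Quot.mk s) h) ?_
  rintro ⟨x⟩
  exact ⟨Quot.mk r x, rfl⟩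

theorem mk_eq_mk_of_forall_mk_eq {r s : α → α → Prop}
    (h : ∀ a b, r a b → Quot.mk s a = Quot.mk s b) {a b : α} (hab : Quot.mk r a = Quot.mk r b) :
    Quot.mk s a = Quot.mk s b :=
  congrArg (Quot.lift (Quot.mk s) h) hab

theorem iff_of_mk_eq_mk {r : α → α → Prop} {P : α → Prop} (h : ∀ a b, r a b → (P a ↔ P b))
    {a b : α} (hab : Quot.mk r a = Quot.mk r b) : P a ↔ P b :=
  iff_of_eq (congrArg (Quot.lift P fun a b hr => propext (h a b hr)) hab)

theorem mk_addPair_of_mk {r : α → α → Prop} {a b x y : α}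
    (h : Quot.mk r x = Quot.mk r y) :
    Quot.mk (addPair r a b) x = Quot.mk (addPair r a b) y :=
  mk_eq_mk_of_forall_mk_eq (fun _ _ h => Quot.sound (Or.inl h)) h

open Classical in
/-- A section of the quotient map that merges the class of `b` into that of `a`. -/
noncomputable def mergeSection (r : α → α → Prop) (a b : α) : Quot (addPair r a b) → Quot r :=
  Quot.lift (fun x => if Quot.mk r x = Quot.mk r b then Quot.mk r a else Quot.mk r x) <| by
    rintro x y (h | ⟨rfl, rfl⟩)
    · simp only [Quot.sound h]
    · simp

theorem numClasses_le_addPair [Finite α] (r : α → α → Prop) (a b : α) :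
    numClasses r ≤ numClasses (addPair r a b) + 1 := by
  have h := Nat.card_le_card_of_surjective
    (fun c : Option (Quot (addPair r a b)) => c.elim (Quot.mk r b) (mergeSection r a b)) (by
      rintro ⟨x⟩
      by_cases hx : Quot.mk r x = Quot.mk r b
      · exact ⟨none, hx.symm⟩
      · exact ⟨some (Quot.mk _ x), if_neg hx⟩)
  rwa [Finite.card_option] at h

theorem numClasses_addPair_add_one_le [Finite α] {r : α → α → Prop} {a b : α}
    (hab : Quot.mk r a ≠ Quot.mk r b) : numClasses (addPair r a b) + 1 ≤ numClasses r := by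
  have hle : ∀ x y, r x y → Quot.mk (addPair r a b) x = Quot.mk (addPair r a b) y :=
    fun x y h => Quot.sound (Or.inl h)
  have hinv : ∀ c, Quot.lift (Quot.mk (addPair r a b)) hle (mergeSection r a b c) = c := by
    rintro ⟨x⟩
    by_cases hx : Quot.mk r x = Quot.mk r b
    · have h1 : mergeSection r a b (Quot.mk _ x) = Quot.mk r a := if_pos hx
      change Quot.lift _ hle (mergeSection r a b (Quot.mk _ x)) = _
      rw [h1]
      have h2 : Quot.mk (addPair r a b) a = Quot.mk (addPair r a b) b :=
        Quot.sound (Or.inr ⟨rfl, rfl⟩)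
      exact h2.trans (mk_eq_mk_of_forall_mk_eq hle hx).symm
    · have h1 : mergeSection r a b (Quot.mk _ x) = Quot.mk r x := if_neg hx
      change Quot.lift _ hle (mergeSection r a b (Quot.mk _ x)) = _
      rw [h1]
  have hne : ∀ c, mergeSection r a b c ≠ Quot.mk r b := by
    rintro ⟨x⟩ h
    by_cases hx : Quot.mk r x = Quot.mk r b
    · exact hab ((if_pos hx).symm.trans h)
    · exact hx ((if_neg hx).symm.trans h)
  have h := Nat.card_le_card_of_injective
    (fun c : Option (Quot (addPair r a b)) => c.elim (Quot.mk r b) (mergeSection r a b)) (by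
      rintro (_ | c) (_ | c') h
      · rfl
      · exact (hne c' h.symm).elim
      · exact (hne c h).elim
      · have h' : mergeSection r a b c = mergeSection r a b c' := h
        rw [← hinv c, h', hinv c'])
  rwa [Finite.card_option] at h

open Classical in
/-- A relation that does not link the elements satisfying `P` with the others has its classes
inside `P` and its classes outside `P`. -/
theorem numClasses_eq_add [Finite α] {r : α → α → Prop} (P : α → Prop)
    (h : ∀ a b, r a b → (P a ↔ P b)) :
    numClasses r = numClasses (fun a b : {a // P a} => r a b) +
      numClasses (fun a b : {a // ¬ P a} => r a b) := by
  unfold numClasses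
  rw [← Nat.card_sum]
  refine Nat.card_congr ⟨Quot.lift (fun a => if ha : P a then Sum.inl (Quot.mk _ ⟨a, ha⟩)
      else Sum.inr (Quot.mk _ ⟨a, ha⟩)) ?_,
    Sum.elim (Quot.lift (fun a => Quot.mk r a) fun a b hab => Quot.sound hab)
      (Quot.lift (fun a => Quot.mk r a) fun a b hab => Quot.sound hab), ?_, ?_⟩
  · intro a b hab
    by_cases ha : P a
    · have hb := (h a b hab).1 ha
      simp only [ha, hb, dif_pos]
      exact congrArg Sum.inl (Quot.sound hab)
    · have hb : ¬ P b := fun hb => ha ((h a b hab).2 hb)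
      rw [dif_neg ha, dif_neg hb]
      exact congrArg Sum.inr (Quot.sound hab)
  · rintro ⟨a⟩
    by_cases ha : P a
    · simp [ha]
    · simp [ha]
  · rintro (⟨⟨a, ha⟩⟩ | ⟨⟨a, ha⟩⟩)
    · simp [ha]
    · simp [ha]

/-- Exchanging two relations outside `P` does not change their total number of classes. -/
theorem numClasses_add_eq_of_exchange [Finite α] {r₁ r₂ s₁ s₂ : α → α → Prop} (P : α → Prop)
    (hr₁ : ∀ a b, r₁ a b → (P a ↔ P b)) (hr₂ : ∀ a b, r₂ a b → (P a ↔ P b))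
    (hs₁ : ∀ a b, s₁ a b → (P a ↔ P b)) (hs₂ : ∀ a b, s₂ a b → (P a ↔ P b))
    (h₁ : ∀ a b, P a → P b → (s₁ a b ↔ r₁ a b)) (h₁' : ∀ a b, ¬ P a → ¬ P b → (s₁ a b ↔ r₂ a b))
    (h₂ : ∀ a b, P a → P b → (s₂ a b ↔ r₂ a b)) (h₂' : ∀ a b, ¬ P a → ¬ P b → (s₂ a b ↔ r₁ a b)) :
    numClasses s₁ + numClasses s₂ = numClasses r₁ + numClasses r₂ := by
  rw [numClasses_eq_add P hr₁, numClasses_eq_add P hr₂, numClasses_eq_add P hs₁,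
    numClasses_eq_add P hs₂]
  have e₁ : (fun a b : {a // P a} => s₁ a b) = fun a b => r₁ a.1 b.1 := by
    ext a b; exact h₁ a b a.2 b.2
  have e₁' : (fun a b : {a // ¬ P a} => s₁ a b) = fun a b => r₂ a.1 b.1 := by
    ext a b; exact h₁' a b a.2 b.2
  have e₂ : (fun a b : {a // P a} => s₂ a b) = fun a b => r₂ a.1 b.1 := by
    ext a b; exact h₂ a b a.2 b.2
  have e₂' : (fun a b : {a // ¬ P a} => s₂ a b) = fun a b => r₁ a.1 b.1 := by
    ext a b; exact h₂' a b a.2 b.2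
  rw [e₁, e₁', e₂, e₂']
  ring

theorem even_card_of_involution (s : Finset α) (f : α → α) (hmem : ∀ a ∈ s, f a ∈ s)
    (hinv : ∀ a ∈ s, f (f a) = a) (hne : ∀ a ∈ s, f a ≠ a) : Even s.card := by
  have h : ∑ _a ∈ s, (1 : ZMod 2) = 0 :=
    Finset.sum_involution (fun a _ => f a) (fun _ _ => by decide) (fun a ha _ => hne a ha)
      hmem hinv
  rw [Finset.sum_const, nsmul_one] at h
  exact (ZMod.natCast_eq_zero_iff_even).1 h

end Classes

/-! ### Deleting edges from a graph -/

namespace SimpleGraph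

variable {V : Type u}

theorem mk_adj_eq_mk_iff_reachable {H : SimpleGraph V} {v w : V} :
    Quot.mk H.Adj v = Quot.mk H.Adj w ↔ H.Reachable v w := by
  constructor
  · intro h
    exact (iff_of_mk_eq_mk (P := fun x => H.Reachable v x)
      (fun a b hab => ⟨fun ha => ha.trans hab.reachable, fun hb => hb.trans hab.symm.reachable⟩)
      h).1 (Reachable.refl v)
  · rintro ⟨p⟩
    induction p with
    | nil => rfl
    | cons h _ ih => exact (Quot.sound h).trans ih

theorem card_connectedComponent [Finite V] (H : SimpleGraph V) :
    Nat.card H.ConnectedComponent = numClasses H.Adj :=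
  le_antisymm
    (numClasses_le_of_forall_mk_eq (s := H.Reachable) fun _ _ h => Quot.sound h.reachable)
    (numClasses_le_of_forall_mk_eq (r := H.Reachable) fun _ _ h =>
      mk_adj_eq_mk_iff_reachable.2 h)

theorem numClasses_adj_bot [Finite V] : numClasses (⊥ : SimpleGraph V).Adj = Nat.card V := by
  refine le_antisymm (Nat.card_le_card_of_surjective (Quot.mk _) Quot.mk_surjective)
    (Nat.card_le_card_of_injective (Quot.mk _) fun v w h => ?_)
  exact (iff_of_mk_eq_mk (P := fun x => v = x) (fun a b hab => hab.elim) h).1 rfl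

theorem numClasses_adj_mono [Finite V] {A H : SimpleGraph V} (h : A ≤ H) :
    numClasses H.Adj ≤ numClasses A.Adj :=
  numClasses_le_of_forall_mk_eq fun _ _ hab => Quot.sound (h hab)

theorem numClasses_adj_deleteEdges_le [Finite V] (H : SimpleGraph V) (v w : V) :
    numClasses (H.deleteEdges {s(v, w)}).Adj ≤ numClasses H.Adj + 1 := by
  refine (numClasses_le_addPair _ v w).trans (Nat.add_le_add_right ?_ 1)
  refine numClasses_le_of_forall_mk_eq fun a b hab => ?_
  by_cases h : s(a, b) = s(v, w)
  · have hvw : Quot.mk (addPair (H.deleteEdges {s(v, w)}).Adj v w) v = Quot.mk _ w :=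
      Quot.sound (Or.inr ⟨rfl, rfl⟩)
    rcases Sym2.eq_iff.1 h with ⟨rfl, rfl⟩ | ⟨rfl, rfl⟩
    · exact hvw
    · exact hvw.symm
  · exact Quot.sound (Or.inl (by simpa [deleteEdges_adj] using ⟨hab, by simpa using h⟩))

theorem card_edgeSet_deleteEdges [Finite V] {H : SimpleGraph V} {v w : V} (h : H.Adj v w) :
    Nat.card (H.deleteEdges {s(v, w)}).edgeSet + 1 = Nat.card H.edgeSet := by
  rw [edgeSet_deleteEdges]
  exact Set.ncard_sdiff_singleton_add_one (s := H.edgeSet) h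

/-- Induction from a graph `A` to the graphs that contain it, one edge at a time. -/
theorem induction_on_deleteEdges [Finite V] {A : SimpleGraph V} {motive : SimpleGraph V → Prop}
    (base : motive A)
    (step : ∀ (H : SimpleGraph V) (v w : V), A ≤ H → H.Adj v w → ¬ A.Adj v w →
      motive (H.deleteEdges {s(v, w)}) → motive H)
    (H : SimpleGraph V) (hH : A ≤ H) : motive H := by
  induction hn : Nat.card H.edgeSet generalizing H with
  | zero =>
    have : H = ⊥ := by
      rw [← edgeSet_eq_empty]
      exact (Set.ncard_eq_zero (Set.toFinite _)).1 hn
    obtain rfl : A = H := le_antisymm hH (this ▸ bot_le)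
    exact base
  | succ n ih =>
    by_cases hA : H ≤ A
    · obtain rfl : A = H := le_antisymm hH hA
      exact base
    · obtain ⟨v, w, hvw, hA⟩ : ∃ v w, H.Adj v w ∧ ¬ A.Adj v w := by
        by_contra! hcon
        exact hA fun v w => hcon v w
      refine step H v w hH hvw hA (ih _ ?_ ?_)
      · intro a b hab
        rw [deleteEdges_adj]
        refine ⟨hH hab, fun h => hA ?_⟩
        have h' : s(a, b) ∈ A.edgeSet := hab
        rw [Set.mem_singleton_iff.1 h] at h'
        exact h'
      · have := card_edgeSet_deleteEdges hvw
        omega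

theorem card_le_numClasses_add_card_edgeSet [Finite V] (H : SimpleGraph V) :
    Nat.card V ≤ numClasses H.Adj + Nat.card H.edgeSet := by
  refine induction_on_deleteEdges (A := ⊥)
    (motive := fun H => Nat.card V ≤ numClasses H.Adj + Nat.card H.edgeSet) ?_ ?_ H bot_le
  · exact numClasses_adj_bot.ge.trans (Nat.le_add_right _ _)
  · intro H v w _ hvw _ ih
    have h1 := numClasses_adj_deleteEdges_le H v w
    have h2 := card_edgeSet_deleteEdges hvw
    omega

end SimpleGraph

/-! ### Faces of the subgraphs of an embedded graph -/

namespace SimpleGraph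

namespace EmbeddingScheme

variable {V : Type u} {G : SimpleGraph V} (R : G.EmbeddingScheme)

/-- The other end of an edge side. -/
def along (p : G.Dart × Bool) : G.Dart × Bool :=
  (p.1.symm, if R.twisted ⟨p.1.edge, p.1.edge_mem⟩ then p.2 else !p.2)

/-- The edge side on the same corner of a face. -/
def corner (p : G.Dart × Bool) : G.Dart × Bool :=
  match p with
  | (d, true) => (R.rot d, false)
  | (d, false) => (R.rot.symm d, true)

theorem along_along (p : G.Dart × Bool) : R.along (R.along p) = p := by
  obtain ⟨d, b⟩ := p
  simp only [along, Dart.symm_symm, Dart.edge_symm]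
  cases R.twisted ⟨d.edge, d.edge_mem⟩ <;> simp

theorem along_not (d : G.Dart) (b : Bool) :
    R.along (d, !b) = ((R.along (d, b)).1, !(R.along (d, b)).2) := by
  simp only [along]
  cases R.twisted ⟨d.edge, d.edge_mem⟩ <;> simp

theorem corner_corner (p : G.Dart × Bool) : R.corner (R.corner p) = p := by
  obtain ⟨d, _ | _⟩ := p <;> simp [corner]

theorem corner_ne (p : G.Dart × Bool) : R.corner p ≠ p := by
  obtain ⟨d, _ | _⟩ := p <;> simp [corner]

theorem along_ne (p : G.Dart × Bool) : R.along p ≠ p := by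
  intro h
  exact p.1.symm_ne (congrArg Prod.fst h)

theorem fst_rot (d : G.Dart) : (R.rot d).fst = d.fst :=
  (R.rot_isCycleOn d.fst).1.mapsTo (rfl : d.fst = d.fst)

/-- Edge sides are followed around corners, along the edges in `A`, and across the edges in `N`,
which are cut off near their ends; at an edge that is in neither of the two sets all four ends of
sides are left open. -/
inductive SideStep (A N : Set (Sym2 V)) : G.Dart × Bool → G.Dart × Bool → Prop
  | corner (d : G.Dart) : SideStep A N (d, true) (R.rot d, false)
  | along (p : G.Dart × Bool) : p.1.edge ∈ A → SideStep A N p (R.along p)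
  | across (d : G.Dart) (b : Bool) : d.edge ∈ N → SideStep A N (d, b) (d, !b)

/-- The steps along the faces of the subgraph `H` of `G`, all on the edge sides of `G`: edges
outside `H` are skipped. In this way every vertex that is isolated in `H` but not in `G` has a
single face. -/
abbrev FaceRel (H : SimpleGraph V) : G.Dart × Bool → G.Dart × Bool → Prop :=
  R.SideStep H.edgeSet H.edgeSetᶜ

instance [Finite V] : Finite G.Dart :=
  Finite.of_injective (fun d : G.Dart => d.toProd) Dart.toProd_injective

theorem numFaces_eq :
    R.numFaces = numClasses (R.FaceRel G) + Nat.card {v : V // G.IsIsolated v} := by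
  have h : R.FaceStep = R.FaceRel G := by
    ext p q
    constructor
    · rintro (d | ⟨d, b⟩)
      · exact SideStep.corner d
      · exact SideStep.along (d, b) d.edge_mem
    · rintro (d | ⟨⟨d, b⟩, _⟩ | ⟨d, b, h⟩)
      · exact FaceStep.corner d
      · exact FaceStep.along d b
      · exact (h d.edge_mem).elim
  rw [numFaces, FacialWalk, h, numClasses]

variable {R}

theorem SideStep.mk_corner {A N : Set (Sym2 V)} (p : G.Dart × Bool) :
    Quot.mk (R.SideStep A N) (R.corner p) = Quot.mk _ p := by
  obtain ⟨d, _ | _⟩ := p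
  · refine Quot.sound ?_
    simpa [EmbeddingScheme.corner] using SideStep.corner (R := R) (A := A) (N := N) (R.rot.symm d)
  · exact (Quot.sound (SideStep.corner d)).symm

theorem SideStep.mono {A N A' N' : Set (Sym2 V)} (hA : A ⊆ A') (hN : N ⊆ N')
    {p q : G.Dart × Bool} (h : R.SideStep A N p q) : R.SideStep A' N' p q := by
  rcases h with d | ⟨p, h⟩ | ⟨d, b, h⟩
  · exact .corner d
  · exact .along p (hA h)
  · exact .across d b (hN h)

theorem SideStep.mk_eq_mono {A N A' N' : Set (Sym2 V)} (hA : A ⊆ A') (hN : N ⊆ N')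
    {p q : G.Dart × Bool} (h : Quot.mk (R.SideStep A N) p = Quot.mk _ q) :
    Quot.mk (R.SideStep A' N') p = Quot.mk _ q :=
  mk_eq_mk_of_forall_mk_eq (fun _ _ h => Quot.sound (h.mono hA hN)) h

/-- The steps stay within the components of a graph that contains `A`. -/
theorem reachable_of_mk_eq {H : SimpleGraph V} {A N : Set (Sym2 V)} (hA : A ⊆ H.edgeSet)
    {p q : G.Dart × Bool} (h : Quot.mk (R.SideStep A N) p = Quot.mk _ q) :
    H.Reachable p.1.fst q.1.fst := by
  refine (iff_of_mk_eq_mk (P := fun x : G.Dart × Bool => H.Reachable p.1.fst x.1.fst) ?_ h).1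
    (Reachable.refl _)
  rintro x _ (d | ⟨_, hx⟩ | ⟨d, b, -⟩)
  · simp [fst_rot]
  · have hadj : H.Adj x.1.fst x.1.snd := hA hx
    exact ⟨fun h => h.trans hadj.reachable, fun h => h.trans hadj.symm.reachable⟩
  · rfl

theorem eq_or_eq_of_edge_eq (d : G.Dart) {q : G.Dart × Bool} (hq : q.1.edge = d.edge) :
    q = (d, true) ∨ q = (d, false) ∨ q = R.along (d, true) ∨ q = R.along (d, false) := by
  obtain ⟨d', b⟩ := q
  rcases dart_edge_eq_iff d' d |>.1 hq with rfl | rfl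
  · cases b <;> simp
  · simp only [along]
    cases R.twisted ⟨d.edge, d.edge_mem⟩ <;> cases b <;> simp

/-- The corners match all edge sides in pairs, and the steps along and across edges match all of
them but the four at the edge of `d`. Hence every class of the steps contains an even number of
these four: a side of this edge leads on to another one. -/
theorem mk_eq_of_open [Finite V] {A N : Set (Sym2 V)} (d : G.Dart)
    (h : ∀ e : Sym2 V, e ∈ A ∨ e ∈ N ↔ e ≠ d.edge) :
    Quot.mk (R.SideStep A N) (d, true) = Quot.mk _ (d, false) ∨
    Quot.mk (R.SideStep A N) (d, true) = Quot.mk _ (R.along (d, true)) ∨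
    Quot.mk (R.SideStep A N) (d, true) = Quot.mk _ (R.along (d, false)) := by
  classical
  have := Fintype.ofFinite (G.Dart × Bool)
  let C : Finset (G.Dart × Bool) :=
    Finset.univ.filter fun q => Quot.mk (R.SideStep A N) q = Quot.mk _ (d, true)
  have hC : ∀ q, q ∈ C ↔ Quot.mk (R.SideStep A N) q = Quot.mk _ (d, true) := by simp [C]
  have h1 : Even C.card := by
    refine even_card_of_involution C R.corner (fun q hq => ?_) (fun q _ => R.corner_corner q)
      (fun q _ => R.corner_ne q)
    rw [hC] at hq ⊢
    exact (SideStep.mk_corner q).trans hq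
  have h2 : Even (C.filter fun q => q.1.edge ≠ d.edge).card := by
    refine even_card_of_involution _
      (fun q => if q.1.edge ∈ A then R.along q else (q.1, !q.2)) (fun q hq => ?_) (fun q _ => ?_)
      (fun q _ => ?_)
    · rw [Finset.mem_filter, hC] at hq ⊢
      split_ifs with hA
      · exact ⟨(Quot.sound (SideStep.along q hA)).symm.trans hq.1, by simpa [along] using hq.2⟩
      · have hN := ((h q.1.edge).2 hq.2).resolve_left hA
        exact ⟨(Quot.sound (SideStep.across q.1 q.2 hN)).symm.trans hq.1, hq.2⟩
    · by_cases hA : q.1.edge ∈ A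
      · have hA' : (R.along q).1.edge ∈ A := by simpa [along] using hA
        simp only [hA, hA', if_true, along_along]
      · simp [hA]
    · split_ifs with hA
      · exact R.along_ne q
      · exact fun h => by simpa using congrArg Prod.snd h
  have h3 : Even (C.filter fun q => q.1.edge = d.edge).card := by
    have h4 := Finset.card_filter_add_card_filter_not (s := C) (fun q => q.1.edge = d.edge)
    rw [← h4] at h1
    exact (Nat.even_add.1 h1).2 h2
  have hmem : (d, true) ∈ C.filter fun q => q.1.edge = d.edge := by simp [hC]
  obtain ⟨q, hq, hne⟩ : ∃ q ∈ C.filter fun q => q.1.edge = d.edge, q ≠ (d, true) := by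
    refine Finset.exists_mem_ne ?_ _
    have := Finset.card_pos.2 ⟨_, hmem⟩
    obtain ⟨m, hm⟩ := h3
    omega
  rw [Finset.mem_filter, hC] at hq
  rcases eq_or_eq_of_edge_eq (R := R) d hq.2 with rfl | rfl | rfl | rfl
  · exact (hne rfl).elim
  · exact Or.inl hq.1.symm
  · exact Or.inr (Or.inl hq.1.symm)
  · exact Or.inr (Or.inr hq.1.symm)

section Delete

variable {H : SimpleGraph V} (d : G.Dart)

theorem mk_eq_of_open_deleteEdges [Finite V] (hd : d.edge ∈ H.edgeSet) :
    Quot.mk (R.SideStep (H.deleteEdges {d.edge}).edgeSet H.edgeSetᶜ) (d, true)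
        = Quot.mk _ (d, false) ∨
    Quot.mk (R.SideStep (H.deleteEdges {d.edge}).edgeSet H.edgeSetᶜ) (d, true)
        = Quot.mk _ (R.along (d, true)) ∨
    Quot.mk (R.SideStep (H.deleteEdges {d.edge}).edgeSet H.edgeSetᶜ) (d, true)
        = Quot.mk _ (R.along (d, false)) := by
  rw [edgeSet_deleteEdges]
  refine mk_eq_of_open d fun e => ?_
  by_cases he : e = d.edge
  · subst he
    simp [hd]
  · by_cases heH : e ∈ H.edgeSet <;> simp [he, heH]

theorem mk_faceRel_deleteEdges_across (b : Bool) :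
    Quot.mk (R.FaceRel (H.deleteEdges {d.edge})) (d, !b) = Quot.mk _ (d, b) :=
  (Quot.sound (SideStep.across d b (by simp [edgeSet_deleteEdges]))).symm

theorem mk_faceRel_deleteEdges_along (b b' : Bool) :
    Quot.mk (R.FaceRel (H.deleteEdges {d.edge})) (R.along (d, b)) =
      Quot.mk _ (R.along (d, b')) := by
  have key : Quot.mk (R.FaceRel (H.deleteEdges {d.edge})) (R.along (d, !true)) =
      Quot.mk _ (R.along (d, true)) := by
    rw [along_not]
    exact (Quot.sound (SideStep.across _ _ (by simp [along]))).symm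
  cases b <;> cases b'
  · rfl
  · exact key
  · exact key.symm
  · rfl

/-- A relation that identifies the linked sides away from the edge of `d`, and the two sides of
this edge at each of its ends, is coarser than the face relation after deleting the edge. -/
theorem mk_eq_of_faceRel_deleteEdges {s : G.Dart × Bool → G.Dart × Bool → Prop}
    (hs : ∀ p q, R.SideStep (H.deleteEdges {d.edge}).edgeSet H.edgeSetᶜ p q →
      Quot.mk s p = Quot.mk s q)
    (h₁ : Quot.mk s (d, true) = Quot.mk s (d, false))
    (h₂ : Quot.mk s (R.along (d, true)) = Quot.mk s (R.along (d, false)))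
    (p q : G.Dart × Bool) (h : R.FaceRel (H.deleteEdges {d.edge}) p q) :
    Quot.mk s p = Quot.mk s q := by
  rcases h with d' | ⟨p, hp⟩ | ⟨d', b, hN⟩
  · exact hs _ _ (.corner d')
  · exact hs _ _ (.along p hp)
  · by_cases hH : d'.edge ∈ H.edgeSet
    · have he : d'.edge = d.edge := by
        by_contra hne
        exact hN (by simp [edgeSet_deleteEdges, hH, hne])
      have key : Quot.mk s (d', true) = Quot.mk s (d', false) := by
        rcases (dart_edge_eq_iff d' d).1 he with rfl | rfl
        · exact h₁
        · simp only [along] at h₂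
          cases htw : R.twisted ⟨d.edge, d.edge_mem⟩ <;> simp only [htw] at h₂
          · exact h₂.symm
          · exact h₂
      cases b
      · exact key.symm
      · exact key
    · exact hs _ _ (.across d' b hH)

theorem mk_eq_of_faceRel {s : G.Dart × Bool → G.Dart × Bool → Prop}
    (hs : ∀ p q, R.SideStep (H.deleteEdges {d.edge}).edgeSet H.edgeSetᶜ p q →
      Quot.mk s p = Quot.mk s q)
    (h : ∀ b, Quot.mk s (d, b) = Quot.mk s (R.along (d, b)))
    (p q : G.Dart × Bool) (hpq : R.FaceRel H p q) :
    Quot.mk s p = Quot.mk s q := by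
  rcases hpq with d' | ⟨p, hp⟩ | ⟨d', b, hN⟩
  · exact hs _ _ (.corner d')
  · by_cases he : p.1.edge = d.edge
    · rcases eq_or_eq_of_edge_eq (R := R) d he with rfl | rfl | rfl | rfl
      · exact h _
      · exact h _
      · rw [along_along]; exact (h _).symm
      · rw [along_along]; exact (h _).symm
    · exact hs _ _ (.along p (by simp [edgeSet_deleteEdges, hp, he]))
  · exact hs _ _ (.across d' b hN)

theorem mk_faceRel_of_open {p q : G.Dart × Bool}
    (h : Quot.mk (R.SideStep (H.deleteEdges {d.edge}).edgeSet H.edgeSetᶜ) p = Quot.mk _ q) :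
    Quot.mk (R.FaceRel H) p = Quot.mk _ q :=
  SideStep.mk_eq_mono (edgeSet_mono (deleteEdges_le _)) subset_rfl h

theorem mk_faceRel_deleteEdges_of_open {p q : G.Dart × Bool}
    (h : Quot.mk (R.SideStep (H.deleteEdges {d.edge}).edgeSet H.edgeSetᶜ) p = Quot.mk _ q) :
    Quot.mk (R.FaceRel (H.deleteEdges {d.edge})) p = Quot.mk _ q :=
  SideStep.mk_eq_mono subset_rfl
    (Set.compl_subset_compl.2 (edgeSet_mono (deleteEdges_le _))) h

theorem mk_faceRel_along (hd : d.edge ∈ H.edgeSet) (b : Bool) :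
    Quot.mk (R.FaceRel H) (d, b) = Quot.mk _ (R.along (d, b)) :=
  Quot.sound (.along (d, b) hd)

theorem numClasses_faceRel_deleteEdges_le [Finite V] :
    numClasses (R.FaceRel (H.deleteEdges {d.edge})) ≤ numClasses (R.FaceRel H) + 1 := by
  refine (numClasses_le_addPair _ (d, true) (R.along (d, true))).trans (Nat.add_le_add_right ?_ 1)
  refine numClasses_le_of_forall_mk_eq (mk_eq_of_faceRel d (fun p q h => ?_) ?_)
  · exact mk_addPair_of_mk (mk_faceRel_deleteEdges_of_open d (Quot.sound h))
  · have h0 : Quot.mk (addPair (R.FaceRel (H.deleteEdges {d.edge})) (d, true) (R.along (d, true)))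
        (d, true) = Quot.mk _ (R.along (d, true)) := Quot.sound (Or.inr ⟨rfl, rfl⟩)
    rintro (_ | _)
    · exact (mk_addPair_of_mk (mk_faceRel_deleteEdges_across d true)).trans
        (h0.trans (mk_addPair_of_mk (mk_faceRel_deleteEdges_along d true false)))
    · exact h0

theorem numClasses_faceRel_le_deleteEdges [Finite V] (hd : d.edge ∈ H.edgeSet) :
    numClasses (R.FaceRel H) ≤ numClasses (R.FaceRel (H.deleteEdges {d.edge})) + 1 := by
  refine (numClasses_le_addPair _ (d, true) (d, false)).trans (Nat.add_le_add_right ?_ 1)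
  have h0 : Quot.mk (addPair (R.FaceRel H) (d, true) (d, false))
        (d, true) = Quot.mk _ (d, false) := Quot.sound (Or.inr ⟨rfl, rfl⟩)
  refine numClasses_le_of_forall_mk_eq (mk_eq_of_faceRel_deleteEdges d (fun p q h => ?_) h0 ?_)
  · exact mk_addPair_of_mk (mk_faceRel_of_open d (Quot.sound h))
  · exact (mk_addPair_of_mk (mk_faceRel_along d hd true)).symm.trans
      (h0.trans (mk_addPair_of_mk (mk_faceRel_along d hd false)))

/-- Both sides of a bridge belong to one face, which splits when the bridge is deleted. -/
theorem numClasses_faceRel_add_one_le_of_bridge [Finite V] (hd : d.edge ∈ H.edgeSet)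
    (hbridge : ¬ (H.deleteEdges {d.edge}).Reachable d.fst d.snd) :
    numClasses (R.FaceRel H) + 1 ≤ numClasses (R.FaceRel (H.deleteEdges {d.edge})) := by
  have hne : Quot.mk (R.FaceRel (H.deleteEdges {d.edge})) (d, true) ≠
      Quot.mk _ (R.along (d, true)) := fun h => hbridge (reachable_of_mk_eq subset_rfl h)
  refine le_trans (Nat.add_le_add_right ?_ 1) (numClasses_addPair_add_one_le hne)
  have h0 : Quot.mk (R.FaceRel H) (d, true) = Quot.mk _ (d, false) := by
    rcases mk_eq_of_open_deleteEdges (R := R) d hd with h | h | h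
    · exact mk_faceRel_of_open d h
    · exact (hbridge (reachable_of_mk_eq subset_rfl h)).elim
    · exact (hbridge (reachable_of_mk_eq subset_rfl h)).elim
  refine numClasses_le_of_forall_mk_eq ?_
  rintro p q (h | ⟨rfl, rfl⟩)
  · refine mk_eq_of_faceRel_deleteEdges d (fun p q h => mk_faceRel_of_open d (Quot.sound h))
      h0 ?_ p q h
    exact (mk_faceRel_along d hd true).symm.trans (h0.trans (mk_faceRel_along d hd false))
  · exact mk_faceRel_along d hd true

/-- Deleting an edge between two different faces merges them. -/
theorem numClasses_faceRel_deleteEdges_add_one_le [Finite V] (hd : d.edge ∈ H.edgeSet)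
    (hne : Quot.mk (R.FaceRel H) (d, true) ≠ Quot.mk _ (d, false)) :
    numClasses (R.FaceRel (H.deleteEdges {d.edge})) + 1 ≤ numClasses (R.FaceRel H) := by
  refine le_trans (Nat.add_le_add_right ?_ 1) (numClasses_addPair_add_one_le hne)
  have h0 : Quot.mk (R.FaceRel (H.deleteEdges {d.edge})) (d, true) =
      Quot.mk _ (R.along (d, true)) := by
    rcases mk_eq_of_open_deleteEdges (R := R) d hd with h | h | h
    · exact (hne (mk_faceRel_of_open d h)).elim
    · exact mk_faceRel_deleteEdges_of_open d h
    · exact (mk_faceRel_deleteEdges_of_open d h).trans (mk_faceRel_deleteEdges_along d _ _)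
  refine numClasses_le_of_forall_mk_eq ?_
  rintro p q (h | ⟨rfl, rfl⟩)
  · refine mk_eq_of_faceRel d (fun p q h => mk_faceRel_deleteEdges_of_open d (Quot.sound h))
      ?_ p q h
    rintro (_ | _)
    · exact (mk_faceRel_deleteEdges_across d true).trans
        (h0.trans (mk_faceRel_deleteEdges_along d _ _))
    · exact h0
  · exact (mk_faceRel_deleteEdges_across d true).symm

end Delete

variable (R) in
/-- The Euler genus of a subgraph `H` of `G`, embedded by the restriction of the scheme. -/
noncomputable def subgenus (H : SimpleGraph V) : ℤ :=
  2 * (numClasses H.Adj : ℤ) - ((Nat.card V : ℤ) - (Nat.card H.edgeSet : ℤ) +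
    ((numClasses (R.FaceRel H) : ℤ) + (Nat.card {v : V // G.IsIsolated v} : ℤ)))

theorem subgenus_self [Finite V] : R.subgenus G = R.eulerGenus := by
  rw [subgenus, eulerGenus, numFaces_eq, card_connectedComponent]
  push_cast
  ring

/-- The Euler genus is monotone under taking subgraphs: the deletion of a bridge adds a component
but also a face, and the deletion of any other edge adds no component and loses at most one face. -/
theorem subgenus_mono [Finite V] {A H : SimpleGraph V} (hAH : A ≤ H) (hH : H ≤ G) :
    R.subgenus A ≤ R.subgenus H := by
  refine induction_on_deleteEdges (A := A)
    (motive := fun H => H ≤ G → R.subgenus A ≤ R.subgenus H) (fun _ => le_rfl) ?_ H hAH hH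
  intro H v w _ hvw _ ih hH
  refine (ih ((deleteEdges_le _).trans hH)).trans ?_
  let d : G.Dart := ⟨(v, w), hH hvw⟩
  have he : s(v, w) = d.edge := rfl
  have hd : d.edge ∈ H.edgeSet := hvw
  have hcard := card_edgeSet_deleteEdges hvw
  unfold subgenus
  rw [he] at hcard ⊢
  by_cases hb : (H.deleteEdges {d.edge}).Reachable d.fst d.snd
  · have h1 : numClasses (H.deleteEdges {d.edge}).Adj ≤ numClasses H.Adj := by
      refine numClasses_le_of_forall_mk_eq fun a b hab => ?_
      rw [mk_adj_eq_mk_iff_reachable]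
      by_cases h : s(a, b) = d.edge
      · rcases Sym2.eq_iff.1 h with ⟨rfl, rfl⟩ | ⟨rfl, rfl⟩
        · exact hb
        · exact hb.symm
      · exact Adj.reachable ((deleteEdges_adj).2 ⟨hab, h⟩)
    have h2 := numClasses_faceRel_le_deleteEdges (R := R) d hd
    omega
  · have h1 := numClasses_adj_deleteEdges_le H v w
    have h2 := numClasses_faceRel_add_one_le_of_bridge (R := R) d hd hb
    rw [he] at h1
    omega

theorem subgenus_le_deleteEdges [Finite V] {H : SimpleGraph V} (d : G.Dart)
    (hd : d.edge ∈ H.edgeSet)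
    (hne : Quot.mk (R.FaceRel H) (d, true) ≠ Quot.mk _ (d, false)) :
    R.subgenus H ≤ R.subgenus (H.deleteEdges {d.edge}) := by
  have h1 := numClasses_adj_mono (deleteEdges_le (G := H) {d.edge})
  have h2 := numClasses_faceRel_deleteEdges_add_one_le d hd hne
  have hcard := card_edgeSet_deleteEdges (H := H) (v := d.fst) (w := d.snd) hd
  have he : s(d.fst, d.snd) = d.edge := rfl
  rw [he] at hcard
  unfold subgenus
  omega

theorem numClasses_faceRel_add_card_le [Finite V] {A H : SimpleGraph V} (hAH : A ≤ H)
    (hH : H ≤ G) :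
    numClasses (R.FaceRel A) + Nat.card A.edgeSet ≤
      numClasses (R.FaceRel H) + Nat.card H.edgeSet := by
  refine induction_on_deleteEdges (A := A)
    (motive := fun H => H ≤ G → numClasses (R.FaceRel A) + Nat.card A.edgeSet ≤
      numClasses (R.FaceRel H) + Nat.card H.edgeSet) (fun _ => le_rfl) ?_ H hAH hH
  intro H v w _ hvw _ ih hH
  refine (ih ((deleteEdges_le _).trans hH)).trans ?_
  have hcard := card_edgeSet_deleteEdges hvw
  have := numClasses_faceRel_deleteEdges_le (R := R) (H := H) ⟨(v, w), hH hvw⟩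
  have he : (⟨(v, w), hH hvw⟩ : G.Dart).edge = s(v, w) := rfl
  rw [he] at this
  omega

end EmbeddingScheme

end SimpleGraph

/-! ### The scheme induced on a subgraph -/

namespace SimpleGraph

namespace EmbeddingScheme

variable {V : Type u} {G : SimpleGraph V} (R : G.EmbeddingScheme)

/-- The inclusion of the darts of a subgraph. -/
def dartOfLE {H : SimpleGraph V} (h : H ≤ G) (d : H.Dart) : G.Dart :=
  ⟨d.toProd, h d.adj⟩

theorem dartOfLE_injective {H : SimpleGraph V} (h : H ≤ G) : Function.Injective (dartOfLE h) :=
  fun _ _ hd => Dart.ext _ _ (congrArg (fun d : G.Dart => d.toProd) hd)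

theorem fst_rot_pow (n : ℕ) (d : G.Dart) : ((R.rot ^ n) d).fst = d.fst := by
  induction n with
  | zero => rfl
  | succ n ih => rw [pow_succ', Equiv.Perm.mul_apply, fst_rot, ih]

theorem exists_rot_pow_eq [Finite V] {d d' : G.Dart} (h : d.fst = d'.fst) :
    ∃ n : ℕ, (R.rot ^ n) d = d' :=
  (R.rot_isCycleOn d'.fst).exists_pow_eq' (Set.toFinite _) h rfl |>.imp fun _ h => h

/-- The first dart of the subgraph after a given one, in the cyclic order at the tail. -/
theorem exists_next_dart [Finite V] {H : SimpleGraph V} (h : H ≤ G) (d : H.Dart) :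
    ∃ d' : H.Dart, ∃ n : ℕ, dartOfLE h d' = (R.rot ^ (n + 1)) (dartOfLE h d) ∧
      ∀ m < n, ((R.rot ^ (m + 1)) (dartOfLE h d)).edge ∉ H.edgeSet := by
  classical
  have hex : ∃ n : ℕ, ((R.rot ^ (n + 1)) (dartOfLE h d)).edge ∈ H.edgeSet := by
    refine ⟨orderOf R.rot - 1, ?_⟩
    have := orderOf_pos R.rot
    rw [Nat.sub_add_cancel this, pow_orderOf_eq_one]
    exact d.adj
  exact ⟨⟨((R.rot ^ (Nat.find hex + 1)) (dartOfLE h d)).toProd, Nat.find_spec hex⟩,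
    Nat.find hex, rfl, fun m hm => Nat.find_min hex hm⟩

variable {R}

/-- Going back around a vertex, across the edges that are not in `H`, one stays in the same face
until one returns to `d` or meets an edge of `H`. -/
theorem mk_rot_pow_eq_or {H : SimpleGraph V} (d : G.Dart) (n : ℕ) :
    Quot.mk (R.FaceRel H) ((R.rot ^ n) d, true) = Quot.mk _ (d, true) ∨
      ∃ d' : G.Dart, d'.fst = d.fst ∧ d'.edge ∈ H.edgeSet ∧
        Quot.mk (R.FaceRel H) ((R.rot ^ n) d, true) = Quot.mk _ (d', true) := by
  induction n with
  | zero => exact Or.inl rfl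
  | succ n ih =>
    by_cases hH : ((R.rot ^ (n + 1)) d).edge ∈ H.edgeSet
    · exact Or.inr ⟨_, R.fst_rot_pow _ d, hH, rfl⟩
    · have h1 : Quot.mk (R.FaceRel H) ((R.rot ^ (n + 1)) d, true) =
          Quot.mk _ ((R.rot ^ n) d, true) := by
        refine (Quot.sound (SideStep.across _ true hH)).trans ?_
        rw [pow_succ', Equiv.Perm.mul_apply]
        exact (Quot.sound (SideStep.corner _)).symm
      rw [h1]
      exact ih

theorem mk_corner_eq_of_forall_notMem {H : SimpleGraph V} (d : G.Dart) (n : ℕ)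
    (h : ∀ m < n, ((R.rot ^ (m + 1)) d).edge ∉ H.edgeSet) :
    Quot.mk (R.FaceRel H) (d, true) = Quot.mk _ ((R.rot ^ (n + 1)) d, false) := by
  induction n with
  | zero => exact Quot.sound (SideStep.corner d)
  | succ n ih =>
    refine (ih fun m hm => h m (hm.trans n.lt_succ_self)).trans ?_
    refine (Quot.sound (SideStep.across _ false (h n n.lt_succ_self))).trans ?_
    rw [pow_succ' _ (n + 1), Equiv.Perm.mul_apply]
    exact Quot.sound (SideStep.corner _)

variable (R) in
/-- The restriction of a scheme of `G` to a subgraph `H` is a scheme of `H` whose Euler genus is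
at most the one that is counted on the edge sides of `G`. -/
theorem exists_scheme_eulerGenus_le_subgenus [Finite V] {H : SimpleGraph V} (h : H ≤ G) :
    ∃ S : H.EmbeddingScheme, S.eulerGenus ≤ R.subgenus H := by
  classical
  choose next k hnext hk using R.exists_next_dart h
  have hfst : ∀ d, (next d).fst = d.fst := fun d =>
    (congrArg (fun d : G.Dart => d.fst) (hnext d)).trans (R.fst_rot_pow _ (dartOfLE h d))
  have hinj : Function.Injective next := by
    -- Of two darts with the same successor, the one with the longer way to it would meet the other.
    have key : ∀ d d', k d ≤ k d' → next d = next d' → d = d' := by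
      intro d d' hle heq
      have h1 : (R.rot ^ (k d + 1)) (dartOfLE h d) =
          (R.rot ^ (k d + 1)) ((R.rot ^ (k d' - k d)) (dartOfLE h d')) := by
        rw [← Equiv.Perm.mul_apply, ← pow_add, ← hnext, heq, hnext]
        congr 2
        omega
      have h2 := (R.rot ^ (k d + 1)).injective h1
      rcases Nat.eq_zero_or_pos (k d' - k d) with h0 | h0
      · rw [h0] at h2
        exact dartOfLE_injective h h2
      · refine (hk d' (k d' - k d - 1) (by omega) ?_).elim
        rw [Nat.sub_add_cancel h0, ← h2]
        exact d.adj
    intro d d' heq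
    rcases le_total (k d) (k d') with hle | hle
    · exact key d d' hle heq
    · exact (key d' d hle heq.symm).symm
  let f : Equiv.Perm H.Dart := Equiv.ofBijective next (Finite.injective_iff_bijective.1 hinj)
  have hf : ∀ d, f d = next d := fun _ => rfl
  -- The powers of the rotation of `G` between darts of `H` are powers of the induced rotation.
  have hpow : ∀ n : ℕ, ∀ d d' : H.Dart, (R.rot ^ n) (dartOfLE h d) = dartOfLE h d' →
      ∃ m : ℕ, (f ^ m) d = d' := by
    intro n
    induction n using Nat.strong_induction_on with
    | _ n ih =>
      intro d d' hn
      rcases Nat.eq_zero_or_pos n with rfl | h0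
      · exact ⟨0, dartOfLE_injective h hn⟩
      · have hle : k d + 1 ≤ n := by
          by_contra hlt
          refine hk d (n - 1) (by omega) ?_
          rw [Nat.sub_add_cancel h0, hn]
          exact d'.adj
        obtain ⟨m, hm⟩ := ih (n - (k d + 1)) (by omega) (next d) d' (by
          rw [hnext, ← Equiv.Perm.mul_apply, ← pow_add, Nat.sub_add_cancel hle, hn])
        exact ⟨m + 1, by rw [pow_succ, Equiv.Perm.mul_apply, hf, hm]⟩
  let S : H.EmbeddingScheme :=
    { rot := f
      rot_isCycleOn := by
        refine fun v => ⟨⟨fun d hd => (hfst d).trans hd, f.injective.injOn, fun d hd => ?_⟩,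
          fun d hd d' hd' => ?_⟩
        · refine ⟨f.symm d, ?_, f.apply_symm_apply d⟩
          have := hfst (f.symm d)
          rw [← hf, f.apply_symm_apply] at this
          exact this.symm.trans hd
        · obtain ⟨n, hn⟩ := R.exists_rot_pow_eq (d := dartOfLE h d) (d' := dartOfLE h d')
            (hd.trans hd'.symm)
          obtain ⟨m, hm⟩ := hpow n d d' hn
          exact ⟨m, by rw [zpow_natCast, hm]⟩
      twisted := fun e => R.twisted ⟨e.1, edgeSet_mono h e.2⟩ }
  refine ⟨S, ?_⟩
  have hwalk : ∀ p q, S.FaceStep p q →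
      Quot.mk (R.FaceRel H) (dartOfLE h p.1, p.2) = Quot.mk _ (dartOfLE h q.1, q.2) := by
    rintro _ _ (d | ⟨d, b⟩)
    · refine (mk_corner_eq_of_forall_notMem _ _ (hk d)).trans ?_
      rw [← hnext]
      rfl
    · exact Quot.sound (SideStep.along (dartOfLE h d, b) d.adj)
  have hdart : ∀ v : {v : V // H.IsIsolated v}, ¬ G.IsIsolated v → ∃ d : G.Dart, d.fst = v := by
    intro v hv
    simp only [IsIsolated, not_forall, not_not] at hv
    obtain ⟨w, hw⟩ := hv
    exact ⟨⟨(v, w), hw⟩, rfl⟩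
  choose e he using hdart
  -- Every face of `H`, on the edge sides of `G`, comes from a facial walk of `S` or from an
  -- isolated vertex of `H`.
  let g : S.FacialWalk ⊕ {v : V // H.IsIsolated v} →
      Quot (R.FaceRel H) ⊕ {v : V // G.IsIsolated v} :=
    Sum.elim (fun c => Sum.inl (Quot.lift (fun p : H.Dart × Bool => Quot.mk _ (dartOfLE h p.1, p.2))
        hwalk c))
      (fun v => if hv : G.IsIsolated v then Sum.inr ⟨v, hv⟩ else Sum.inl (Quot.mk _ (e v hv, true)))
  have hmem : ∀ (d : G.Dart) (b : Bool), d.edge ∈ H.edgeSet →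
      Sum.inl (Quot.mk _ (d, b)) ∈ Set.range g :=
    fun d b hd => ⟨Sum.inl (Quot.mk _ (⟨d.toProd, hd⟩, b)), rfl⟩
  have hg : Function.Surjective g := by
    rintro (⟨d, b⟩ | ⟨v, hv⟩)
    · suffices htrue : Sum.inl (Quot.mk _ (d, true)) ∈ Set.range g by
        by_cases hd : d.edge ∈ H.edgeSet
        · exact hmem d b hd
        · cases b
          · have h1 : Quot.mk (R.FaceRel H) (d, false) = Quot.mk _ (d, true) :=
              Quot.sound (SideStep.across d false hd)
            rw [h1]
            exact htrue
          · exact htrue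
      by_cases hiso : H.IsIsolated d.fst
      · have hG : ¬ G.IsIsolated d.fst := fun hG => hG d.snd d.adj
        obtain ⟨n, hn⟩ := R.exists_rot_pow_eq (d := e ⟨d.fst, hiso⟩ hG) (d' := d) (he _ _)
        rcases mk_rot_pow_eq_or (R := R) (H := H) (e ⟨d.fst, hiso⟩ hG) n with h1 | ⟨d', h1, h2, -⟩
        · rw [hn] at h1
          rw [h1]
          exact ⟨Sum.inr ⟨d.fst, hiso⟩, dif_neg hG⟩
        · have h2' : H.Adj d'.fst d'.snd := h2
          rw [h1.trans (he _ _)] at h2'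
          exact (hiso _ h2').elim
      · simp only [IsIsolated, not_forall, not_not] at hiso
        obtain ⟨w, hw⟩ := hiso
        obtain ⟨n, hn⟩ := R.exists_rot_pow_eq (d := ⟨(d.fst, w), h hw⟩) (d' := d) rfl
        rcases mk_rot_pow_eq_or (R := R) (H := H) ⟨(d.fst, w), h hw⟩ n with h1 | ⟨d', -, h2, h1⟩
        · rw [hn] at h1
          rw [h1]
          exact hmem _ _ hw
        · rw [hn] at h1
          rw [h1]
          exact hmem _ _ h2
    · have hv' : H.IsIsolated v := fun w hw => hv w (h hw)
      exact ⟨Sum.inr ⟨v, hv'⟩, dif_pos hv⟩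
  have : Finite S.FacialWalk := Finite.of_surjective (Quot.mk _) Quot.mk_surjective
  have hcard := Nat.card_le_card_of_surjective g hg
  rw [Nat.card_sum, Nat.card_sum] at hcard
  rw [eulerGenus, subgenus, card_connectedComponent, numFaces, numClasses]
  unfold numClasses
  omega

end EmbeddingScheme

end SimpleGraph

/-! ### Breadth-first forests -/

namespace SimpleGraph

variable {V : Type u}

/-- The restriction of a graph to the vertices satisfying `P`, on the same vertex set. -/
def restrictTo (G : SimpleGraph V) (P : V → Prop) : SimpleGraph V where
  Adj v w := G.Adj v w ∧ P v ∧ P w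
  symm := ⟨fun _ _ h => ⟨h.1.symm, h.2.2, h.2.1⟩⟩
  loopless := ⟨fun _ h => h.1.ne rfl⟩

theorem restrictTo_le (H : SimpleGraph V) (P : V → Prop) : H.restrictTo P ≤ H :=
  fun _ _ h => h.1

/-- A breadth-first spanning forest: every vertex has a level, which is the distance from the root
of its component, and every vertex that is not a root has a parent in the previous level. The
parent of a root is the root itself. -/
structure LayeredForest (G : SimpleGraph V) where
  /-- the level of a vertex -/
  lev : V → ℕ
  /-- the parent of a vertex -/
  par : V → V
  lev_le : ∀ v w, G.Adj v w → lev v ≤ lev w + 1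
  par_root : ∀ v, lev v = 0 → par v = v
  adj_par : ∀ v, lev v ≠ 0 → G.Adj v (par v)
  lev_par : ∀ v, lev (par v) = lev v - 1
  root_unique : ∀ v w, G.Reachable v w → lev v = 0 → lev w = 0 → v = w

theorem nonempty_layeredForest (G : SimpleGraph V) : Nonempty G.LayeredForest := by
  let root : V → V := fun v => (G.connectedComponentMk v).out
  have hroot : ∀ v, G.Reachable (root v) v := fun v =>
    ConnectedComponent.exact (Quot.out_eq (G.connectedComponentMk v))
  have hsame : ∀ v w, G.Reachable v w → root v = root w := fun v w h =>
    congrArg Quot.out (ConnectedComponent.sound h)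
  have hadj : ∀ v w, G.Adj v w → G.dist (root v) v ≤ G.dist (root w) w + 1 := by
    intro v w h
    obtain ⟨p, hp⟩ := (hroot w).exists_walk_length_eq_dist
    rw [hsame v w h.reachable, ← hp]
    have := dist_le (p.concat h.symm)
    rwa [Walk.length_concat] at this
  have hpar : ∀ v, ∃ w, (G.dist (root v) v = 0 → w = v) ∧ (G.dist (root v) v ≠ 0 → G.Adj v w) ∧
      G.dist (root w) w = G.dist (root v) v - 1 := by
    intro v
    by_cases h0 : G.dist (root v) v = 0
    · exact ⟨v, fun _ => rfl, fun h => (h h0).elim, by omega⟩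
    · have hstep : ∀ (r : V) (p : G.Walk v r), p.length ≠ 0 →
          ∃ w, G.Adj v w ∧ G.dist w r + 1 ≤ p.length := by
        intro r p hp
        cases p with
        | nil => exact (hp rfl).elim
        | @cons _ w _ h p => exact ⟨w, h, Nat.succ_le_succ (dist_le p)⟩
      obtain ⟨p, hp⟩ := (hroot v).symm.exists_walk_length_eq_dist
      rw [dist_comm] at hp
      obtain ⟨w, hw, hle⟩ := hstep _ p (hp ▸ h0)
      refine ⟨w, fun h => (h0 h).elim, fun _ => hw, ?_⟩
      have h1 := hadj v w hw
      rw [hp, dist_comm, hsame v w hw.reachable] at hle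
      rw [hsame v w hw.reachable] at h1 ⊢
      omega
  choose par h1 h2 h3 using hpar
  refine ⟨⟨fun v => G.dist (root v) v, par, hadj, h1, h2, h3, fun v w h hv hw => ?_⟩⟩
  rw [← (hroot v).dist_eq_zero_iff.1 hv, ← (hroot w).dist_eq_zero_iff.1 hw, hsame v w h]

namespace LayeredForest

variable {G : SimpleGraph V} (F : G.LayeredForest)

/-- The edges from the vertices to their parents. -/
def graph : SimpleGraph V where
  Adj v w := v ≠ w ∧ (F.par v = w ∨ F.par w = v)
  symm := ⟨fun _ _ h => ⟨h.1.symm, h.2.symm⟩⟩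
  loopless := ⟨fun _ h => h.1 rfl⟩

theorem lev_ne_zero {v : V} (h : F.par v ≠ v) : F.lev v ≠ 0 :=
  fun h0 => h (F.par_root v h0)

theorem graph_le : F.graph ≤ G := by
  rintro v w ⟨hne, rfl | rfl⟩
  · exact F.adj_par v (F.lev_ne_zero hne.symm)
  · exact (F.adj_par w (F.lev_ne_zero hne)).symm

theorem lev_iterate (n : ℕ) (v : V) : F.lev (F.par^[n] v) = F.lev v - n := by
  induction n with
  | zero => rfl
  | succ n ih => rw [Function.iterate_succ_apply', F.lev_par, ih, Nat.sub_sub]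

theorem reachable_iterate {P : V → Prop} (hP : ∀ v, P v → P (F.par v)) (n : ℕ) {v : V}
    (hv : P v) : P (F.par^[n] v) ∧ (F.graph.restrictTo P).Reachable v (F.par^[n] v) := by
  induction n with
  | zero => exact ⟨hv, Reachable.refl v⟩
  | succ n ih =>
    rw [Function.iterate_succ_apply']
    refine ⟨hP _ ih.1, ih.2.trans ?_⟩
    by_cases h : F.par^[n] v = F.par (F.par^[n] v)
    · rw [← h]
    · exact Adj.reachable ⟨⟨h, Or.inl rfl⟩, ih.1, hP _ ih.1⟩

/-- Within a set of vertices that is closed under parents, the forest is as connected as `G`. -/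
theorem reachable_of_reachable {P : V → Prop} (hP : ∀ v, P v → P (F.par v)) {v w : V} (hv : P v)
    (hw : P w) (h : G.Reachable v w) : (F.graph.restrictTo P).Reachable v w := by
  obtain ⟨-, h1⟩ := F.reachable_iterate hP (F.lev v) hv
  obtain ⟨-, h2⟩ := F.reachable_iterate hP (F.lev w) hw
  have hle : F.graph.restrictTo P ≤ G := (restrictTo_le _ _).trans F.graph_le
  have heq := F.root_unique _ _ (((h1.mono hle).symm.trans h).trans (h2.mono hle))
    (by rw [lev_iterate, Nat.sub_self]) (by rw [lev_iterate, Nat.sub_self])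
  rw [heq] at h1
  exact h1.trans h2.symm

theorem numClasses_graph_le [Finite V] : numClasses F.graph.Adj ≤ numClasses G.Adj :=
  numClasses_le_of_forall_mk_eq fun _ _ h => mk_adj_eq_mk_iff_reachable.2
    ((F.reachable_of_reachable (P := fun _ => True) (fun _ _ => trivial) trivial trivial
      h.reachable).mono (restrictTo_le _ _))

theorem card_edgeSet_add_numClasses_le [Finite V] :
    Nat.card F.graph.edgeSet + numClasses G.Adj ≤ Nat.card V := by
  classical
  have h1 : Nat.card F.graph.edgeSet ≤ Nat.card {v // F.lev v ≠ 0} := by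
    refine Nat.card_le_card_of_surjective
      (fun v => ⟨s(v.1, F.par v.1), (F.adj_par v.1 v.2).ne, Or.inl rfl⟩) ?_
    rintro ⟨e, he⟩
    induction e with | _ v w
    obtain ⟨hne, rfl | rfl⟩ : F.graph.Adj v w := he
    · exact ⟨⟨v, F.lev_ne_zero hne.symm⟩, rfl⟩
    · exact ⟨⟨w, F.lev_ne_zero hne⟩, Subtype.ext Sym2.eq_swap⟩
  have h2 : numClasses G.Adj ≤ Nat.card {v // F.lev v = 0} := by
    refine Nat.card_le_card_of_surjective (fun v => Quot.mk _ v.1) ?_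
    rintro ⟨v⟩
    refine ⟨⟨F.par^[F.lev v] v, by rw [lev_iterate, Nat.sub_self]⟩, ?_⟩
    have := (F.reachable_iterate (P := fun _ => True) (fun _ _ => trivial) (F.lev v)
      (v := v) trivial).2
    exact (mk_adj_eq_mk_iff_reachable.2
      (this.mono ((restrictTo_le _ _).trans F.graph_le))).symm
  have h3 : Nat.card {v // F.lev v = 0} + Nat.card {v // F.lev v ≠ 0} = Nat.card V := by
    rw [← Nat.card_sum]
    exact Nat.card_congr (Equiv.sumCompl fun v => F.lev v = 0)
  omega

end LayeredForest

/-! ### Cutting a surface to a disc -/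

namespace EmbeddingScheme

variable {G : SimpleGraph V} {R : G.EmbeddingScheme}

/-- If all edge sides at a vertex belong to the same face, for every vertex, then there is one
face in each component. -/
theorem numClasses_faceRel_add_isolated [Finite V] {A : SimpleGraph V} (hA : A ≤ G)
    (h : ∀ d d' : G.Dart, d.fst = d'.fst → ∀ b b',
      Quot.mk (R.FaceRel A) (d, b) = Quot.mk _ (d', b')) :
    numClasses (R.FaceRel A) + Nat.card {v : V // G.IsIsolated v} = numClasses A.Adj := by
  classical
  have hiso : ∀ v w, G.IsIsolated v → Quot.mk A.Adj v = Quot.mk A.Adj w → v = w := by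
    intro v w hv hvw
    refine (iff_of_mk_eq_mk (P := fun x => v = x) (fun a b hab => ?_) hvw).1 rfl
    constructor
    · rintro rfl; exact (hv b (hA hab)).elim
    · rintro rfl; exact (hv a (hA hab).symm).elim
  have hface : ∀ p q : G.Dart × Bool, Quot.mk A.Adj p.1.fst = Quot.mk A.Adj q.1.fst →
      Quot.mk (R.FaceRel A) p = Quot.mk _ q := by
    intro p q hpq
    have key : ∀ a b, A.Adj a b →
        (∀ q : G.Dart × Bool, q.1.fst = a → Quot.mk (R.FaceRel A) p = Quot.mk _ q) →
        (∀ q : G.Dart × Bool, q.1.fst = b → Quot.mk (R.FaceRel A) p = Quot.mk _ q) := by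
      intro a b hab ha q hq
      let d : G.Dart := ⟨(a, b), hA hab⟩
      refine (ha (d, true) rfl).trans ((Quot.sound (SideStep.along (d, true) hab)).trans ?_)
      exact h _ _ hq.symm _ _
    exact (iff_of_mk_eq_mk (P := fun x => ∀ q : G.Dart × Bool, q.1.fst = x →
      Quot.mk (R.FaceRel A) p = Quot.mk _ q) (fun a b hab => ⟨key a b hab, key b a hab.symm⟩)
      hpq).1 (fun q hq => h _ _ hq.symm _ _) q rfl
  unfold numClasses
  rw [← Nat.card_sum]
  refine Nat.card_congr (Equiv.ofBijective
    (Sum.elim (Quot.lift (fun p : G.Dart × Bool => Quot.mk A.Adj p.1.fst) fun p q hpq =>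
        mk_adj_eq_mk_iff_reachable.2 (reachable_of_mk_eq subset_rfl (Quot.sound hpq)))
      fun v => Quot.mk A.Adj v.1) ⟨?_, ?_⟩)
  · rintro (⟨d, b⟩ | ⟨v, hv⟩) (⟨d', b'⟩ | ⟨w, hw⟩) heq
    · exact congrArg Sum.inl (hface (d, b) (d', b') heq)
    · have := hiso w _ hw (Eq.symm heq)
      subst this
      exact (hw _ d.adj).elim
    · have := hiso v _ hv heq
      subst this
      exact (hv _ d'.adj).elim
    · have := hiso v w hv heq
      subst this
      rfl
  · rintro ⟨v⟩
    by_cases hv : G.IsIsolated v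
    · exact ⟨Sum.inr ⟨v, hv⟩, rfl⟩
    · simp only [IsIsolated, not_forall, not_not] at hv
      obtain ⟨w, hw⟩ := hv
      exact ⟨Sum.inl (Quot.mk _ (⟨(v, w), hw⟩, true)), rfl⟩

theorem numClasses_faceRel_bot [Finite V] :
    numClasses (R.FaceRel ⊥) + Nat.card {v : V // G.IsIsolated v} = Nat.card V := by
  rw [numClasses_faceRel_add_isolated bot_le, numClasses_adj_bot]
  have hb : ∀ (d : G.Dart) (b : Bool),
      Quot.mk (R.FaceRel ⊥) (d, b) = Quot.mk _ (d, true) := by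
    rintro d (_ | _)
    · exact Quot.sound (SideStep.across d false (by simp))
    · rfl
  intro d d' hdd' b b'
  rw [hb d b, hb d' b']
  obtain ⟨n, rfl⟩ := R.exists_rot_pow_eq hdd'
  rcases mk_rot_pow_eq_or (R := R) (H := ⊥) d n with h | ⟨d', -, h, -⟩
  · exact h.symm
  · simp at h

/-- Going around a vertex, one stays in the same face, if all edges at the vertex but perhaps one
have the same face on both sides. -/
theorem mk_eq_of_same_sides [Finite V] {A : SimpleGraph V} (p : G.Dart)
    (h : ∀ d : G.Dart, d.fst = p.fst → d ≠ p →
      Quot.mk (R.FaceRel A) (d, true) = Quot.mk _ (d, false))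
    (d : G.Dart) (hd : d.fst = p.fst) (b : Bool) :
    Quot.mk (R.FaceRel A) (d, b) = Quot.mk _ (p, true) := by
  have htrue : ∀ d : G.Dart, d.fst = p.fst →
      Quot.mk (R.FaceRel A) (d, true) = Quot.mk _ (p, true) := by
    intro d hd
    obtain ⟨n, rfl⟩ := R.exists_rot_pow_eq hd.symm
    clear hd
    induction n with
    | zero => rfl
    | succ n ih =>
      by_cases hp : (R.rot ^ (n + 1)) p = p
      · rw [hp]
      · refine (h _ (R.fst_rot_pow _ _) hp).trans (Eq.trans ?_ ih)
        rw [pow_succ', Equiv.Perm.mul_apply]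
        exact (Quot.sound (SideStep.corner _)).symm
  cases b
  · have h1 := SideStep.mk_corner (R := R) (A := A.edgeSet) (N := A.edgeSetᶜ) (d, false)
    refine h1.symm.trans (htrue _ ?_)
    have := R.fst_rot (R.rot.symm d)
    rw [Equiv.apply_symm_apply] at this
    exact this.symm.trans hd
  · exact htrue d hd

/-- If all edges of `A` outside a spanning forest have the same face on both sides, then there is
only one face in each component: by induction from the leaves, also the forest edges have the same
face on both sides. -/
theorem mk_eq_of_forest [Finite V] (F : G.LayeredForest) {A : SimpleGraph V}
    (h : ∀ d : G.Dart, d.edge ∈ A.edgeSet → d.edge ∉ F.graph.edgeSet →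
      Quot.mk (R.FaceRel A) (d, true) = Quot.mk _ (d, false))
    (d d' : G.Dart) (hdd' : d.fst = d'.fst) (b b' : Bool) :
    Quot.mk (R.FaceRel A) (d, b) = Quot.mk _ (d', b') := by
  obtain ⟨M, hM⟩ : ∃ M, ∀ v, F.lev v ≤ M := by
    obtain ⟨M, hM⟩ := (Set.finite_range F.lev).bddAbove
    exact ⟨M, fun v => hM ⟨v, rfl⟩⟩
  induction hn : M - F.lev d.fst using Nat.strong_induction_on generalizing d d' b b' with
  | _ n ih =>
    have hside : ∀ δ : G.Dart, δ.fst = d.fst → δ.snd ≠ F.par d.fst →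
        Quot.mk (R.FaceRel A) (δ, true) = Quot.mk _ (δ, false) := by
      intro δ hδ hpar
      by_cases hA : δ.edge ∈ A.edgeSet
      · by_cases hT : δ.edge ∈ F.graph.edgeSet
        · obtain ⟨hne, h1⟩ : F.graph.Adj δ.fst δ.snd := hT
          have h2 : F.par δ.snd = δ.fst := h1.resolve_left fun h => hpar (by rw [← hδ, h])
          have h3 := F.lev_ne_zero (v := δ.snd) (by rw [h2]; exact hne)
          have h4 := F.lev_par δ.snd
          have h5 := hM δ.snd
          rw [h2, hδ] at h4
          refine (mk_faceRel_along δ hA true).trans (Eq.trans ?_ (mk_faceRel_along δ hA false).symm)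
          refine ih (M - F.lev δ.snd) (by omega) δ.symm δ.symm rfl _ _ rfl
        · exact h δ hA hT
      · exact Quot.sound (SideStep.across δ true hA)
    -- The dart to the parent, if there is one, is the possible exception.
    obtain ⟨p, hp, hpne⟩ : ∃ p : G.Dart, p.fst = d.fst ∧ ∀ δ : G.Dart, δ.fst = d.fst → δ ≠ p →
        δ.snd ≠ F.par d.fst := by
      by_cases hex : ∃ p : G.Dart, p.fst = d.fst ∧ p.snd = F.par d.fst
      · obtain ⟨p, hp, hp'⟩ := hex
        exact ⟨p, hp, fun δ hδ hne hδ' =>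
          hne (Dart.ext _ _ (Prod.ext (hδ.trans hp.symm) (hδ'.trans hp'.symm)))⟩
      · exact ⟨d, rfl, fun δ hδ _ hδ' => hex ⟨δ, hδ, hδ'⟩⟩
    have key := mk_eq_of_same_sides (R := R) (A := A) p
      fun δ hδ hne => hside δ (hδ.trans hp) (hpne δ (hδ.trans hp) hne)
    exact (key d hp.symm b).trans (key d' (hdd'.symm.trans hp.symm) b').symm

/-- The Euler genus is additive for vertex-disjoint subgraphs. All terms in its definition are
compared with those of the empty graph, which has one component and one face for each vertex. -/
theorem subgenus_add_of_disjoint [Finite V] (P : V → Prop) {H Y : SimpleGraph V}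
    (hH : ∀ v w, H.Adj v w → ¬ P v ∧ ¬ P w) (hY : ∀ v w, Y.Adj v w → P v ∧ P w) :
    R.subgenus (H ⊔ Y) = R.subgenus H + R.subgenus Y := by
  have hstep : ∀ S : SimpleGraph V, (∀ v w, S.Adj v w → (P v ↔ P w)) →
      ∀ p q, R.FaceRel S p q → (P p.1.fst ↔ P q.1.fst) := by
    intro S hS p q hpq
    rcases hpq with d | ⟨_, hp⟩ | ⟨d, b, -⟩
    · simp [fst_rot]
    · exact hS _ _ hp
    · rfl
  have hH' : ∀ v w, H.Adj v w → (P v ↔ P w) := fun v w h => iff_of_false (hH v w h).1 (hH v w h).2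
  have hY' : ∀ v w, Y.Adj v w → (P v ↔ P w) := fun v w h => iff_of_true (hY v w h).1 (hY v w h).2
  have hK' : ∀ v w, (H ⊔ Y).Adj v w → (P v ↔ P w) := fun v w h => h.elim (hH' v w) (hY' v w)
  have hb' : ∀ v w, (⊥ : SimpleGraph V).Adj v w → (P v ↔ P w) := fun v w h => h.elim
  have hcongr : ∀ S S' : SimpleGraph V, ∀ p q : G.Dart × Bool,
      (∀ w, S.Adj p.1.fst w ↔ S'.Adj p.1.fst w) → R.FaceRel S p q → R.FaceRel S' p q := by
    intro S S' p q hS hpq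
    rcases hpq with d | ⟨_, hp⟩ | ⟨d, b, hN⟩
    · exact .corner d
    · exact .along p ((hS _).1 hp)
    · exact .across d b fun h => hN ((hS _).2 h)
  have hcongr' : ∀ S S' : SimpleGraph V, ∀ p q : G.Dart × Bool,
      (∀ w, S.Adj p.1.fst w ↔ S'.Adj p.1.fst w) → (R.FaceRel S p q ↔ R.FaceRel S' p q) :=
    fun S S' p q h => ⟨hcongr S S' p q h, hcongr S' S p q fun w => (h w).symm⟩
  have hin : ∀ v, P v → ∀ w, ((H ⊔ Y).Adj v w ↔ Y.Adj v w) := fun v hv w =>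
    ⟨fun h => h.resolve_left fun h => (hH v w h).1 hv, Or.inr⟩
  have hout : ∀ v, ¬ P v → ∀ w, ((H ⊔ Y).Adj v w ↔ H.Adj v w) := fun v hv w =>
    ⟨fun h => h.resolve_right fun h => hv (hY v w h).1, Or.inl⟩
  have hin' : ∀ v, P v → ∀ w, ((⊥ : SimpleGraph V).Adj v w ↔ H.Adj v w) := fun v hv w =>
    ⟨False.elim, fun h => (hH v w h).1 hv⟩
  have hout' : ∀ v, ¬ P v → ∀ w, ((⊥ : SimpleGraph V).Adj v w ↔ Y.Adj v w) := fun v hv w =>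
    ⟨False.elim, fun h => hv (hY v w h).1⟩
  have h1 := numClasses_add_eq_of_exchange (s₁ := (H ⊔ Y).Adj) (s₂ := (⊥ : SimpleGraph V).Adj)
    (r₁ := Y.Adj) (r₂ := H.Adj) P hY' hH' hK' hb' (fun v w hv _ => hin v hv w)
    (fun v w hv _ => hout v hv w) (fun v w hv _ => hin' v hv w) (fun v w hv _ => hout' v hv w)
  have h2 := numClasses_add_eq_of_exchange (s₁ := R.FaceRel (H ⊔ Y)) (s₂ := R.FaceRel ⊥)
    (r₁ := R.FaceRel Y) (r₂ := R.FaceRel H) (fun p => P p.1.fst) (hstep _ hY') (hstep _ hH')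
    (hstep _ hK') (hstep _ hb')
    (fun p q hp _ => hcongr' _ _ p q (hin _ hp)) (fun p q hp _ => hcongr' _ _ p q (hout _ hp))
    (fun p q hp _ => hcongr' _ _ p q (hin' _ hp)) (fun p q hp _ => hcongr' _ _ p q (hout' _ hp))
  have h3 : Nat.card (H ⊔ Y).edgeSet = Nat.card H.edgeSet + Nat.card Y.edgeSet := by
    rw [edgeSet_sup]
    refine Set.ncard_union_eq ?_
    rw [Set.disjoint_left]
    intro e he he'
    induction e with | _ v w
    exact (hH v w he).1 (hY v w he').1
  have h4 := numClasses_faceRel_bot (R := R)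
  rw [numClasses_adj_bot] at h1
  unfold subgenus
  omega

end EmbeddingScheme

end SimpleGraph

/-! ### Queue layouts from layerings -/

namespace SimpleGraph

variable {V : Type u}

/-- The colours of the layout: three for each queue of `G - Z`, for the edges that stay within a
level and for those to the next level, upwards or downwards in the order, and two for each of the
`m` positions of vertices of `Z` in a level. -/
inductive LayerColour (k m : ℕ)
  | same (q : Fin k)
  | up (q : Fin k)
  | down (q : Fin k)
  | back (j : Fin m)
  | next (j : Fin m)

/-- The colours are numbered. -/
def LayerColour.equiv (k m : ℕ) :
    LayerColour k m ≃ (Fin k ⊕ Fin k ⊕ Fin k) ⊕ (Fin m ⊕ Fin m) where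
  toFun
    | same q => .inl (.inl q)
    | up q => .inl (.inr (.inl q))
    | down q => .inl (.inr (.inr q))
    | back j => .inr (.inl j)
    | next j => .inr (.inr j)
  invFun
    | .inl (.inl q) => same q
    | .inl (.inr (.inl q)) => up q
    | .inl (.inr (.inr q)) => down q
    | .inr (.inl j) => back j
    | .inr (.inr j) => next j
  left_inv := by rintro (_ | _ | _ | _ | _) <;> rfl
  right_inv := by rintro ((_ | _ | _) | (_ | _)) <;> rfl

/-- The edges `vw` that may receive a given colour. A vertex of `Z` owns the edges to its own
level and to the next one, and those to the vertices outside `Z` in the previous level. -/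
def LayerColour.Fits {G : SimpleGraph V} {k m : ℕ} {Z : V → Prop}
    (L : (G.restrictTo fun v => ¬ Z v).QueueLayout k) (lev idx : V → ℕ)
    (v w : V) : LayerColour k m → Prop
  | same q => lev v = lev w ∧
      ∃ h : (G.restrictTo fun v => ¬ Z v).Adj v w, L.queue ⟨s(v, w), h⟩ = q
  | up q => lev w = lev v + 1 ∧ L.order.lt v w ∧
      ∃ h : (G.restrictTo fun v => ¬ Z v).Adj v w, L.queue ⟨s(v, w), h⟩ = q
  | down q => lev w = lev v + 1 ∧ L.order.lt w v ∧
      ∃ h : (G.restrictTo fun v => ¬ Z v).Adj v w, L.queue ⟨s(v, w), h⟩ = q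
  | back j => Z v ∧ idx v = j ∧ (lev w = lev v ∨ lev w + 1 = lev v ∧ ¬ Z w)
  | next j => Z v ∧ idx v = j ∧ lev w = lev v + 1

/-- Let `lev` be a layering of `G`, and let `Z` be a set of vertices with at most `m` elements in
each layer. A `k`-queue layout of `G - Z` yields a `(3k + 2m)`-queue layout of `G`: the vertices
are ordered by their layers, within a layer first the vertices of `Z`, and then by the given
layout. -/
theorem exists_queueLayout_of_layering {G : SimpleGraph V} {k m : ℕ} {Z : V → Prop}
    (L : (G.restrictTo fun v => ¬ Z v).QueueLayout k) (lev : V → ℕ)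
    (hlev : ∀ v w, G.Adj v w → lev v ≤ lev w + 1) (idx : V → ℕ) (hm : ∀ v, Z v → idx v < m)
    (hidx : ∀ v w, Z v → Z w → idx v = idx w → lev v = lev w → v = w) :
    Nonempty (G.QueueLayout (3 * k + 2 * m)) := by
  classical
  have hex : ∀ e : G.edgeSet, ∃ c : LayerColour k m, ∃ v w,
      e.1 = s(v, w) ∧ c.Fits L lev idx v w := by
    rintro ⟨e, he⟩
    induction e with | _ v w
    have hvw : G.Adj v w := he
    -- By symmetry, `w` is not in a lower layer than `v`.
    wlog hle : lev v ≤ lev w generalizing v w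
    · obtain ⟨c, a, b, hab, hc⟩ := this w v hvw.symm hvw.symm (by omega)
      exact ⟨c, a, b, Sym2.eq_swap.trans hab, hc⟩
    have h1 := hlev w v hvw.symm
    by_cases hv : Z v
    · rcases Nat.eq_or_lt_of_le hle with h | h
      · exact ⟨.back ⟨idx v, hm v hv⟩, v, w, rfl, hv, rfl, Or.inl h.symm⟩
      · exact ⟨.next ⟨idx v, hm v hv⟩, v, w, rfl, hv, rfl, by omega⟩
    by_cases hw : Z w
    · rcases Nat.eq_or_lt_of_le hle with h | h
      · exact ⟨.back ⟨idx w, hm w hw⟩, w, v, Sym2.eq_swap, hw, rfl, Or.inl h⟩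
      · exact ⟨.back ⟨idx w, hm w hw⟩, w, v, Sym2.eq_swap, hw, rfl, Or.inr ⟨by omega, hv⟩⟩
    have hH : (G.restrictTo fun v => ¬ Z v).Adj v w := ⟨hvw, hv, hw⟩
    rcases Nat.eq_or_lt_of_le hle with h | h
    · exact ⟨.same (L.queue ⟨s(v, w), hH⟩), v, w, rfl, h, hH, rfl⟩
    · have hlt : L.order.lt v w ∨ L.order.lt w v :=
        let _ := L.order
        lt_or_gt_of_ne hvw.ne
      rcases hlt with hlt | hlt
      · exact ⟨.up (L.queue ⟨s(v, w), hH⟩), v, w, rfl, by omega, hlt, hH, rfl⟩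
      · exact ⟨.down (L.queue ⟨s(v, w), hH⟩), v, w, rfl, by omega, hlt, hH, rfl⟩
  choose c hc using hex
  let _ := L.order
  let key : V → ℕ ×ₗ Bool ×ₗ V := fun v => toLex (lev v, toLex (decide (¬ Z v), v))
  have hkey : Function.Injective key := fun v w h => by
    have := congrArg (fun p => (ofLex (ofLex p).2).2) h
    exact this
  have hcard : Nat.card (LayerColour k m) = 3 * k + 2 * m := by
    rw [Nat.card_congr (LayerColour.equiv k m)]
    simp only [Nat.card_eq_fintype_card, Fintype.card_sum, Fintype.card_fin]
    ring
  have : Finite (LayerColour k m) := Finite.of_equiv _ (LayerColour.equiv k m).symm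
  let num : LayerColour k m ≃ Fin (3 * k + 2 * m) := Finite.equivFinOfCardEq hcard
  refine ⟨⟨LinearOrder.lift' key hkey, fun e => num (c e), ?_⟩⟩
  intro v w x y hvw hxy h1 h2 h3 heq
  -- What the order says, in terms of layers, `Z`, and the given layout.
  have hlt : ∀ a b : V, key a < key b → lev a ≤ lev b ∧ (lev a = lev b → Z b → Z a) ∧
      (lev a = lev b → ¬ Z a → ¬ Z b → L.order.lt a b) := by
    intro a b hab
    simp only [key, Prod.Lex.toLex_lt_toLex] at hab
    refine ⟨by omega, fun he hb => ?_, fun he ha hb => ?_⟩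
    · by_contra ha
      simp only [he, ha, hb, lt_irrefl, true_and, false_or, not_true_eq_false, not_false_iff,
        decide_true, decide_false] at hab
      rcases hab with h | ⟨h, -⟩ <;> exact absurd h (by decide)
    · simp only [he, ha, hb, lt_irrefl, true_and, false_or] at hab
      exact hab
  have hnum := num.injective heq
  obtain ⟨a, b, hab, hfab⟩ := hc ⟨s(v, w), hvw⟩
  obtain ⟨p, q, hpq, hfpq⟩ := hc ⟨s(x, y), hxy⟩
  rw [← hnum] at hfpq
  have k1 := hlt v x h1
  have k2 := hlt x y h2
  have k3 := hlt y w h3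
  have n1 : v ≠ x := fun h => by subst h; exact lt_irrefl (key v) h1
  have n2 : v ≠ y := fun h => by subst h; exact lt_irrefl (key x) (h2.trans h1)
  have n3 : x ≠ w := fun h => by subst h; exact lt_irrefl (key x) (h2.trans h3)
  have n4 : y ≠ w := fun h => by subst h; exact lt_irrefl (key y) h3
  have hpq' : s(x, y) = s(p, q) := hpq
  have hab' : s(v, w) = s(a, b) := hab
  have hq : ∀ a b v w : V, s(v, w) = s(a, b) → ∀ i, (∃ h, L.queue ⟨s(a, b), h⟩ = i) →
      ∃ h, L.queue ⟨s(v, w), h⟩ = i := by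
    intro a b v w he i hi
    rwa [he]
  have hZ : ∀ a b, (G.restrictTo fun v => ¬ Z v).Adj a b → ¬ Z a ∧ ¬ Z b := fun _ _ h => h.2
  have hown : Z a → Z p → idx a = idx p → lev a ≠ lev p := fun ha hp hi hl => by
    have hap := hidx a p ha hp hi hl
    subst hap
    rcases Sym2.eq_iff.1 hab' with ⟨rfl, rfl⟩ | ⟨rfl, rfl⟩ <;>
      rcases Sym2.eq_iff.1 hpq' with ⟨rfl, rfl⟩ | ⟨rfl, rfl⟩ <;> contradiction
  cases hcol : c ⟨s(v, w), hvw⟩ with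
  | same i =>
    rw [hcol] at hfab hfpq
    obtain ⟨hl, hi⟩ := hfab
    obtain ⟨hl', hi'⟩ := hfpq
    obtain ⟨h, hi₂⟩ := hq _ _ _ _ hab' _ hi
    obtain ⟨h', hi₂'⟩ := hq _ _ _ _ hpq' _ hi'
    have hvw : lev v = lev w := by
      rcases Sym2.eq_iff.1 hab' with ⟨rfl, rfl⟩ | ⟨rfl, rfl⟩ <;> omega
    have z := hZ _ _ h
    have z' := hZ _ _ h'
    exact L.not_nested v w x y h h' (k1.2.2 (by omega) z.1 z'.1) (k2.2.2 (by omega) z'.1 z'.2)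
      (k3.2.2 (by omega) z'.2 z.2) (hi₂.trans hi₂'.symm)
  | up i =>
    rw [hcol] at hfab hfpq
    obtain ⟨hl, ho, hi⟩ := hfab
    obtain ⟨hl', ho', hi'⟩ := hfpq
    obtain ⟨h, hi₂⟩ := hq _ _ _ _ hab' _ hi
    obtain ⟨h', hi₂'⟩ := hq _ _ _ _ hpq' _ hi'
    have z := hZ _ _ h
    have z' := hZ _ _ h'
    rcases Sym2.eq_iff.1 hab' with ⟨rfl, rfl⟩ | ⟨rfl, rfl⟩ <;>
      rcases Sym2.eq_iff.1 hpq' with ⟨rfl, rfl⟩ | ⟨rfl, rfl⟩ <;> try omega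
    exact L.not_nested v w x y h h' (k1.2.2 (by omega) z.1 z'.1) ho'
      (k3.2.2 (by omega) z'.2 z.2) (hi₂.trans hi₂'.symm)
  | down i =>
    rw [hcol] at hfab hfpq
    obtain ⟨hl, ho, hi⟩ := hfab
    obtain ⟨hl', ho', hi'⟩ := hfpq
    obtain ⟨h, hi₂⟩ := hq _ _ _ _ (Sym2.eq_swap.trans hab') _ hi
    obtain ⟨h', hi₂'⟩ := hq _ _ _ _ (Sym2.eq_swap.trans hpq') _ hi'
    have z := hZ _ _ h
    have z' := hZ _ _ h'
    rcases Sym2.eq_iff.1 hab' with ⟨rfl, rfl⟩ | ⟨rfl, rfl⟩ <;>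
      rcases Sym2.eq_iff.1 hpq' with ⟨rfl, rfl⟩ | ⟨rfl, rfl⟩ <;> try omega
    exact L.not_nested y x w v h' h (k3.2.2 (by omega) z'.1 z.1) ho
      (k1.2.2 (by omega) z.2 z'.2) (hi₂'.trans hi₂.symm)
  | back j =>
    rw [hcol] at hfab hfpq
    obtain ⟨hz, hi, hl⟩ := hfab
    obtain ⟨hz', hi', hl'⟩ := hfpq
    have hne := hown hz hz' (hi.trans hi'.symm)
    have k12 : lev v = lev y → Z y → Z v := fun h hy => k1.2.1 (by omega) (k2.2.1 (by omega) hy)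
    rcases Sym2.eq_iff.1 hab' with ⟨rfl, rfl⟩ | ⟨rfl, rfl⟩ <;>
      rcases Sym2.eq_iff.1 hpq' with ⟨rfl, rfl⟩ | ⟨rfl, rfl⟩ <;> grind
  | next j =>
    rw [hcol] at hfab hfpq
    obtain ⟨hz, hi, hl⟩ := hfab
    obtain ⟨hz', hi', hl'⟩ := hfpq
    have hne := hown hz hz' (hi.trans hi'.symm)
    rcases Sym2.eq_iff.1 hab' with ⟨rfl, rfl⟩ | ⟨rfl, rfl⟩ <;>
      rcases Sym2.eq_iff.1 hpq' with ⟨rfl, rfl⟩ | ⟨rfl, rfl⟩ <;> omega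

end SimpleGraph

/-! ### Planarizing sets of vertices -/

namespace SimpleGraph

variable {V : Type u}

namespace EmbeddingScheme

variable {G : SimpleGraph V} (R : G.EmbeddingScheme)

/-- A spanning forest extends to a subgraph that has the Euler genus of `G` and only one face in
each component: edges outside the forest with different faces on their sides are deleted as long
as there are any. -/
theorem exists_one_face_subgraph [Finite V] (F : G.LayeredForest) :
    ∃ A : SimpleGraph V, F.graph ≤ A ∧ A ≤ G ∧ R.subgenus A = R.subgenus G ∧
      numClasses (R.FaceRel A) + Nat.card {v : V // G.IsIsolated v} = numClasses A.Adj := by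
  obtain ⟨A, hA⟩ := (Set.toFinite {A : SimpleGraph V | F.graph ≤ A ∧ A ≤ G ∧
    R.subgenus G ≤ R.subgenus A}).exists_minimal ⟨G, F.graph_le, le_rfl, le_rfl⟩
  obtain ⟨⟨hFA, hAG, hgen⟩, hmin⟩ := hA
  refine ⟨A, hFA, hAG, le_antisymm (subgenus_mono hAG le_rfl) hgen,
    numClasses_faceRel_add_isolated hAG (mk_eq_of_forest F fun d hd hdF => ?_)⟩
  by_contra hne
  have hle : A ≤ A.deleteEdges {d.edge} := by
    refine hmin ⟨fun v w hvw => ?_, (deleteEdges_le _).trans hAG,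
      hgen.trans (subgenus_le_deleteEdges d hd hne)⟩ (deleteEdges_le _)
    refine deleteEdges_adj.2 ⟨hFA hvw, fun h => hdF ?_⟩
    rw [← Set.mem_singleton_iff.1 h]
    exact hvw
  have := edgeSet_mono hle hd
  simp [edgeSet_deleteEdges] at this

/-- Let `A` be as in `exists_one_face_subgraph`, and let `Z` be a set of vertices that is closed
under parents and contains all ends of the edges of `A` outside the forest. Then the subgraph of
`A` on `Z` has the Euler genus of the whole surface, so that nothing remains for `G - Z`. -/
theorem isPlanar_of_closed [Finite V] (F : G.LayeredForest) {A : SimpleGraph V}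
    (hFA : F.graph ≤ A) (hAG : A ≤ G) (hgen : R.subgenus A = R.subgenus G)
    (hface : numClasses (R.FaceRel A) + Nat.card {v : V // G.IsIsolated v} = numClasses A.Adj)
    {Z : V → Prop} (hZ : ∀ v, Z v → Z (F.par v))
    (hX : ∀ v w, A.Adj v w → ¬ F.graph.Adj v w → Z v) :
    (G.restrictTo fun v => ¬ Z v).IsPlanar ∧
      (Nat.card ↥(A.edgeSet \ F.graph.edgeSet) : ℤ) = R.eulerGenus := by
  have hX' : ∀ v w, A.Adj v w → ¬ F.graph.Adj v w → Z v ∧ Z w := fun v w h hF =>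
    ⟨hX v w h hF, hX w v h.symm fun h => hF h.symm⟩
  set X : Set (Sym2 V) := A.edgeSet \ F.graph.edgeSet with hXdef
  set Y := A.restrictTo Z with hY
  set T := F.graph.restrictTo Z with hT
  set H := G.restrictTo (fun v => ¬ Z v) with hH
  have hHG : H ≤ G := restrictTo_le _ _
  have hYA : Y ≤ A := restrictTo_le _ _
  -- The numbers of edges, components and faces.
  have e1 : Nat.card A.edgeSet = Nat.card F.graph.edgeSet + Nat.card X :=
    ((congrArg Set.ncard (Set.union_sdiff_cancel (edgeSet_mono hFA))).symm.trans
      (Set.ncard_union_eq Set.disjoint_sdiff_right))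
  have e2 : Nat.card Y.edgeSet = Nat.card T.edgeSet + Nat.card X := by
    have h1 : Y.edgeSet = T.edgeSet ∪ X := by
      ext e
      induction e with | _ v w
      change (A.Adj v w ∧ Z v ∧ Z w) ↔ (F.graph.Adj v w ∧ Z v ∧ Z w) ∨
        (A.Adj v w ∧ ¬ F.graph.Adj v w)
      constructor
      · rintro ⟨h, hz⟩
        by_cases hF : F.graph.Adj v w
        · exact Or.inl ⟨hF, hz⟩
        · exact Or.inr ⟨h, hF⟩
      · rintro (⟨h, hz⟩ | ⟨h, hF⟩)
        · exact ⟨hFA h, hz⟩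
        · exact ⟨h, hX' v w h hF⟩
    refine (congrArg Set.ncard h1).trans (Set.ncard_union_eq ?_)
    exact Set.disjoint_left.2 fun e he he' =>
      he'.2 (edgeSet_mono (restrictTo_le _ _) he)
  have c1 : numClasses A.Adj = numClasses G.Adj :=
    le_antisymm ((numClasses_adj_mono hFA).trans F.numClasses_graph_le) (numClasses_adj_mono hAG)
  have c2 : numClasses T.Adj ≤ numClasses Y.Adj :=
    numClasses_le_of_forall_mk_eq fun v w h => mk_adj_eq_mk_iff_reachable.2
      (F.reachable_of_reachable hZ h.2.1 h.2.2 (hAG h.1).reachable)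
  have c3 := card_le_numClasses_add_card_edgeSet T
  have c4 := card_le_numClasses_add_card_edgeSet F.graph
  have c5 := F.card_edgeSet_add_numClasses_le
  have c6 := F.numClasses_graph_le
  have f1 := numClasses_faceRel_add_card_le (R := R) hYA hAG
  have gA : R.subgenus A = Nat.card X := by
    unfold subgenus
    omega
  have gY : (Nat.card X : ℤ) ≤ R.subgenus Y := by
    unfold subgenus
    omega
  have gadd := subgenus_add_of_disjoint (R := R) Z (H := H) (Y := Y) (fun v w h => h.2)
    (fun v w h => h.2)
  have gK := subgenus_mono (R := R) (sup_le hHG (hYA.trans hAG)) le_rfl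
  obtain ⟨S, hS⟩ := R.exists_scheme_eulerGenus_le_subgenus hHG
  refine ⟨⟨S, ?_⟩, ?_⟩
  · push_cast
    omega
  · rw [← subgenus_self, ← hgen, gA]

end EmbeddingScheme

/-- A graph with Euler genus `g` has a layering and a set `Z` of vertices, at most `2g` in each
layer, such that `G - Z` is planar. -/
theorem exists_layering_isPlanar [Finite V] {G : SimpleGraph V} {g : ℕ}
    (hG : G.EmbedsInEulerGenus g) :
    ∃ (lev : V → ℕ) (Z : V → Prop) (idx : V → ℕ), (∀ v w, G.Adj v w → lev v ≤ lev w + 1) ∧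
      (∀ v, Z v → idx v < 2 * g) ∧
      (∀ v w, Z v → Z w → idx v = idx w → lev v = lev w → v = w) ∧
      (G.restrictTo fun v => ¬ Z v).IsPlanar := by
  classical
  obtain ⟨R, hR⟩ := hG
  obtain ⟨F⟩ := G.nonempty_layeredForest
  obtain ⟨A, hFA, hAG, hgen, hface⟩ := R.exists_one_face_subgraph F
  -- The ends of the edges of `A` outside the forest.
  let tip : ↥(A.edgeSet \ F.graph.edgeSet) × Bool → V :=
    fun e => if e.2 then (Quot.out e.1.1).1 else (Quot.out e.1.1).2
  have hend : ∀ v w, A.Adj v w → ¬ F.graph.Adj v w → v ∈ Set.range tip := by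
    intro v w hvw hF
    let e : ↥(A.edgeSet \ F.graph.edgeSet) := ⟨s(v, w), hvw, hF⟩
    have h1 : s((Quot.out s(v, w)).1, (Quot.out s(v, w)).2) = s(v, w) := Quot.out_eq _
    rcases Sym2.eq_iff.1 h1 with ⟨h, -⟩ | ⟨-, h⟩
    · exact ⟨(e, true), h⟩
    · exact ⟨(e, false), h⟩
  let Z : V → Prop := fun v => ∃ e n, n ≤ F.lev (tip e) ∧ F.par^[n] (tip e) = v
  have hZ : ∀ v, Z v → Z (F.par v) := by
    rintro _ ⟨e, n, hn, rfl⟩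
    rcases Nat.eq_or_lt_of_le hn with h | h
    · rw [F.par_root _ (by rw [F.lev_iterate, h, Nat.sub_self])]
      exact ⟨e, n, hn, rfl⟩
    · exact ⟨e, n + 1, h, Function.iterate_succ_apply' _ _ _⟩
  obtain ⟨hplanar, hcard⟩ := R.isPlanar_of_closed F hFA hAG hgen hface hZ (fun v w hvw hF => by
    obtain ⟨e, rfl⟩ := hend v w hvw hF
    exact ⟨e, 0, Nat.zero_le _, rfl⟩)
  have hnum : Nat.card (↥(A.edgeSet \ F.graph.edgeSet) × Bool) ≤ 2 * g := by
    rw [Nat.card_prod, Nat.card_eq_fintype_card (α := Bool), Fintype.card_bool]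
    omega
  let num := Finite.equivFin (↥(A.edgeSet \ F.graph.edgeSet) × Bool)
  have hidx : ∀ v, ∃ i : ℕ, Z v → ∃ e, i = num e ∧ F.par^[F.lev (tip e) - F.lev v] (tip e) = v := by
    intro v
    by_cases hv : Z v
    · obtain ⟨e, n, hn, rfl⟩ := hv
      refine ⟨num e, fun _ => ⟨e, rfl, ?_⟩⟩
      rw [F.lev_iterate, Nat.sub_sub_self hn]
    · exact ⟨0, fun h => (hv h).elim⟩
  choose idx hidx using hidx
  refine ⟨F.lev, Z, idx, F.lev_le, fun v hv => ?_, fun v w hv hw hi hl => ?_, hplanar⟩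
  · obtain ⟨e, he, -⟩ := hidx v hv
    rw [he]
    exact (num e).2.trans_le hnum
  · obtain ⟨e, he, hev⟩ := hidx v hv
    obtain ⟨e', he', hew⟩ := hidx w hw
    obtain rfl : e = e' := num.injective (Fin.ext (by rw [← he, ← he', hi]))
    rw [← hev, ← hew, hl]

/-- Queues may be left empty. -/
def QueueLayout.castLE {G : SimpleGraph V} {k k' : ℕ} (h : k ≤ k') (L : G.QueueLayout k) :
    G.QueueLayout k' where
  order := L.order
  queue e := Fin.castLE h (L.queue e)
  not_nested v w x y hvw hxy h1 h2 h3 heq :=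
    L.not_nested v w x y hvw hxy h1 h2 h3 (Fin.castLE_injective h heq)

end SimpleGraph

theorem mainTheorem4 (k g : ℕ)
    (hk : ∀ (W : Type u) [Finite W] (H : SimpleGraph W), H.IsPlanar → H.queueNumber ≤ k)
    (V : Type u) [Finite V] (G : SimpleGraph V) (hg : G.eulerGenus = g) :
    G.queueNumber ≤ 3 * k + 4 * g := by
  obtain ⟨lev, Z, idx, hlev, hm, hidx, hplanar⟩ :=
    SimpleGraph.exists_layering_isPlanar (hg ▸ G.embedsInEulerGenus_eulerGenus)
  obtain ⟨L⟩ := (G.restrictTo fun v => ¬ Z v).nonempty_queueLayout_queueNumber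
  have h := SimpleGraph.exists_queueLayout_of_layering (L.castLE (hk V _ hplanar)) lev hlev idx
    hm hidx
  rw [← mul_assoc] at h
  exact Nat.sInf_le h
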